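/- **Theorem (Existence of disconnected tangents).** Let $(X_\infty,d_\infty,\mu_\infty)$ be the metric measure space constructed below, for an arbitrary integer $n_0\ge 100$ and an arbitrary admissible choice of $N(\cdot)$. Then for $\mu_\infty$-a.e. $p\in X_\infty$ there is a tangent of $X_\infty$ at $p$ which is not topologically connected. *Tangents.* A tangent (blow-up) of a metric space $X$ at $p$ is a complete pointed metric space $(Y,q)$ which is the pointed Gromov–Hausdorff limit of $(\frac1{r_m}X,p)$ for some sequence of positive numbers $r_m\to0$, where $\frac1{r}X$ is $X$ with the metric divided by $r$. (Pointed Gromov–Hausdorff convergence $(X_m,p_m)\to(Y,q)$: for all $R,\varepsilon>0$ and all large $m$ there is a map $f:B(p_m,R)\to Y$ with $f(p_m)=q$, with distortion less than $\varepsilon$, and such that the $\varepsilon$-neighbourhood of its image contains $B(q,R-\varepsilon)$.) *Parameters.* For each integer $n\ge 26$ choose $N=N(n)\in\mathbb N$ with $3\mid 2N+1$ and $\frac1{2N+1}\in[\frac1{128n},\frac1{32n}]$. Put $n_k=n_0+k$ and $\bar n_k=\sum_{1\le j\le k}n_j^3$ (so $\bar n_0=0$). *The spaces $X_l$.* $X_0=[0,1]^3$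 with the Euclidean metric and Lebesgue measure $\mu_0$; it has a single cell, of side $s_0=1$, and no gates. Let $\bar n_k\le l<\bar n_{k+1}$ and write $n=n_{k+1}$, $N=N(n)$. Given $X_l$, a complex of cubical cells of side $s_l$ some of which are called gates, with metric $d_l$ and measure $\mu_l$, the cells *to be doubled* are all cells if $l=\bar n_k$, and all cells which are not gates if $l>\bar n_k$. In each cell $Q$ to be doubled, replace the concentric closed cube $K_Q$ of side $s_l/3$ by two copies, one green and one red, glued along $\partial K_Q$. This gives $X_{l+1}$ and a projection $\pi_{l+1,l}:X_{l+1}\to X_l$ collapsing the two copies. Its cells, of side $s_{l+1}=s_l/(2N+1)$, are obtained by subdividing each side of the old cells into $2N+1$ equal parts (lifted to both copies). A cell of $X_{l+1}$ is a gate if it is one of the two lifts of the central subcube of a cell that was doubled, or if it is contained in a gate of $X_l$ that was not doubled. For each cell $Q$ to be doubled let $c_Q^{\rm green},c_Q^{\rm red}$ be the two lifts of its centre. A *cover sheet* is a lift of $X_l$ to $X_{l+1}$ obtained by choosing one colour for each cell to be doubled. For $p,q\in X_{l+1}$ let $$\varrho(p,q)=\begin{cases}d_l(\pi_{l+1,l}(p),\pi_{l+1,l}(q))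 & \text{if some cover sheet contains } p \text{ and } q,\\ \frac{s_l}{4n} &\text{if }\{p,q\}=\{c_Q^{\rm green},c_Q^{\rm red}\}\text{ for some cell } Q \text{ to be doubled},\\ +\infty&\text{otherwise,}\end{cases}$$ and let $d_{l+1}(p,q)$ be the infimum of $\sum_i\varrho(p_i,p_{i+1})$ over finite chains $p=p_0,\dots,p_m=q$. The measure $\mu_{l+1}$ is obtained from $\mu_l$ by giving half of the mass to each of the two copies of each $K_Q$; thus $(\pi_{l+1,l})_\#\mu_{l+1}=\mu_l$. *The limit.* $X_\infty$ is the set of sequences $(x_l)_{l\ge0}$ with $x_l\in X_l$ and $\pi_{l+1,l}(x_{l+1})=x_l$, with the metric $d_\infty(x,y)=\limsup_{l\to\infty}d_l(x_l,y_l)$, and $\mu_\infty$ is the Borel probability measure on $X_\infty$ that projects to $\mu_l$ for every $l$, that is, the average of the Lebesgue measures of the chromatic sheets of $X_\infty$ (the copies of $[0,1]^3$ obtained by fixing, at each step, one colour for all doubled cells) with respect to independent fair choices of the colours. -/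

import Mathlib

noncomputable section

namespace NqcDiamond

open MeasureTheory Filter Topology
open scoped ENNReal

/-! ### Parameters and combinatorics of the construction -/

/-- The free choices in the construction: the integer `n₀ ≥ 100` and, for each diamond parameter
`n ≥ 26`, an integer `N n` such that dividing `[0,1]` into `2 * N n + 1` equal intervals gives
intervals of length in `[1/(128 n), 1/(32 n)]`, with `2 * N n + 1` divisible by `3`. -/
structure Params where
  n₀ : ℕ
  n₀_ge : 100 ≤ n₀
  N : ℕ → ℕ
  N_dvd : ∀ n, 26 ≤ n → 3 ∣ 2 * N n + 1
  N_size : ∀ n : ℕ, 26 ≤ n →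
    1 / (2 * (N n : ℝ) + 1) ∈ Set.Icc (1 / (128 * (n : ℝ))) (1 / (32 * (n : ℝ)))

/-- Admissible parameters exist. -/
instance : Nonempty Params := by
  refine ⟨⟨100, le_rfl, fun n => 33 * n + 1, fun n _ => ⟨22 * n + 1, by ring⟩, fun n hn => ?_⟩⟩
  have h : (26 : ℝ) ≤ n := by exact_mod_cast hn
  constructor
  · apply one_div_le_one_div_of_le <;> push_cast <;> linarith
  · apply one_div_le_one_div_of_le <;> push_cast <;> linarith

/-- Euclidean three-space. -/
abbrev E3 : Type := EuclideanSpace ℝ (Fin 3)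

/-- The unit cube `[0,1]³` with the Euclidean metric. -/
abbrev Cube : Type := {x : E3 // ∀ i, x i ∈ Set.Icc (0 : ℝ) 1}

/-- The two colours of the copies of a doubled subcube. -/
abbrev Color : Type := Bool

abbrev green : Color := false

abbrev red : Color := true

variable (P : Params)

namespace Params

/-- The end `n̄ₖ = ∑_{1 ≤ j ≤ k} nⱼ³` of the `k`-th block of levels, where `nⱼ = n₀ + j`. -/
def nbar (k : ℕ) : ℕ := ∑ j ∈ Finset.Icc 1 k, (P.n₀ + j) ^ 3

/-- The index `k` with `n̄ₖ ≤ l < n̄ₖ₊₁`. -/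
def block (l : ℕ) : ℕ := sInf {k | l < P.nbar (k + 1)}

/-- The diamond parameter `nₖ₊₁` used in passing from level `l` to level `l + 1`,
for `n̄ₖ ≤ l < n̄ₖ₊₁`. -/
def diamParam (l : ℕ) : ℕ := P.n₀ + (P.block l + 1)

/-- Number of subdivisions of each side in passing from the cells of level `l` to those of
level `l + 1`. -/
def sub (l : ℕ) : ℕ := 2 * P.N (P.diamParam l) + 1

/-- Number of cells of level `l` along each side of the unit cube. -/
def gridSize : ℕ → ℕ
  | 0 => 1
  | l + 1 => gridSize l * P.sub l

/-- The common side length of the cells of level `l`. -/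
def slen (l : ℕ) : ℝ := 1 / (P.gridSize l : ℝ)

/-- The length assigned to the jump pairs created in passing from level `l` to level `l + 1`,
that is `slen(Q) / (4 n)`. -/
def jumpLen (l : ℕ) : ℝ := P.slen l / (4 * (P.diamParam l : ℝ))

end Params

/-- Grid cubes of level `l` in the unit cube: `z` stands for the cube
`∏ᵢ [zᵢ slen l, (zᵢ + 1) slen l]`. Each of them is the common image of the cells of `X_l` above it;
a cell of `X_l` is given by a grid cube together with a colour label. -/
def gridCells (l : ℕ) : Set (Fin 3 → ℕ) := {z | ∀ i, z i < P.gridSize l}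

/-- The centre of a grid cube. -/
def center (l : ℕ) (z : Fin 3 → ℕ) : E3 :=
  WithLp.toLp 2 fun i => ((z i : ℝ) + 1 / 2) * P.slen l

/-- The interior of the concentric subcube `K` (one third of the side) of a grid cube. -/
def core (l : ℕ) (z : Fin 3 → ℕ) : Set E3 :=
  {x | ∀ i, |x i - center P l z i| < P.slen l / 6}

/-- The grid cube of level `l` that contains the grid cube `z` of level `l + 1`. -/
def parent (l : ℕ) (z : Fin 3 → ℕ) : Fin 3 → ℕ := fun i => z i / P.sub l

/-- `z` is the central cube among the subdivisions of its parent. -/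
def IsCentral (l : ℕ) (z : Fin 3 → ℕ) : Prop := ∀ i, z i % P.sub l = P.N (P.diamParam l)

/-- The cells to be doubled at level `l`, given the gates `G` of level `l`: all cells if `l` is one
of the `n̄ₖ`, and the cells which are not gates otherwise. -/
def toDoubleOf (l : ℕ) (G : Set (Fin 3 → ℕ)) : Set (Fin 3 → ℕ) :=
  {z ∈ gridCells P l | (∃ k, l = P.nbar k) ∨ z ∉ G}

/-- The gates of level `l`. A cell of level `l + 1` is a gate if it is the central cell in a cell
of level `l` that was doubled, or if it comes from subdividing a gate of level `l` that was not
doubled. Both lifts of a cell have the same status, so the gates are recorded through their image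
in the unit cube. -/
def gates : ℕ → Set (Fin 3 → ℕ)
  | 0 => ∅
  | l + 1 => {z ∈ gridCells P (l + 1) |
      (parent P l z ∈ toDoubleOf P l (gates l) ∧ IsCentral P l z) ∨
      (parent P l z ∉ toDoubleOf P l (gates l) ∧ parent P l z ∈ gates l)}

/-- The cells of level `l` which are replaced by a diamond in passing to level `l + 1`. -/
def toDouble (l : ℕ) : Set (Fin 3 → ℕ) := toDoubleOf P l (gates P l)

/-- The union of the interiors of the subcubes that are doubled in passing from level `l` to
level `l + 1`. -/
def doubledRegion (l : ℕ) : Set E3 := ⋃ z ∈ toDouble P l, core P l z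

/-! ### The spaces of the inverse system -/

/-- The space `X_l`. A point of `X_l` is a point of the unit cube together with a colour for each
of the steps `i < l` at which it lies in the interior of a doubled subcube; for the other steps
(where the two copies are glued or no doubling takes place) the label is green by convention.
Thus `X_{l+1}` is `X_l` with, for every cell `Q` to be doubled, the subcube `K` of `Q` replaced by
two copies glued along the boundary of `K`. -/
@[ext]
structure Level (l : ℕ) where
  pos : Cube
  col : Fin l → Color
  col_eq_red : ∀ i, col i = red → (pos : E3) ∈ doubledRegion P i

variable {P}

/-- The projection `X_{l+1} → X_l` collapsing the two copies of each doubled subcube. -/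
def Level.proj {l : ℕ} (p : Level P (l + 1)) : Level P l where
  pos := p.pos
  col := fun i => p.col i.castSucc
  col_eq_red := fun i h => p.col_eq_red i.castSucc h

/-- The colour chosen at the last step. -/
def Level.lastCol {l : ℕ} (p : Level P (l + 1)) : Color := p.col (Fin.last l)

/-- The cover sheet of `X_{l+1}` obtained by choosing the lift of colour `σ Q` for every cell `Q` of
`X_l` that is doubled. A cell `Q` of `X_l` is given by a grid cube and a colour label. -/
def coverSheet {l : ℕ} (σ : (Fin 3 → ℕ) × (Fin l → Color) → Color) : Set (Level P (l + 1)) :=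
  {p | ∀ z ∈ toDouble P l, (p.pos : E3) ∈ core P l z → p.lastCol = σ (z, p.proj.col)}

/-- `p`, `q` are the two lifts in `X_{l+1}` of the centre of a cell of `X_l` that is doubled. -/
def IsJumpPair {l : ℕ} (p q : Level P (l + 1)) : Prop :=
  p.proj = q.proj ∧ p.lastCol ≠ q.lastCol ∧ ∃ z ∈ toDouble P l, (p.pos : E3) = center P l z

/-- The infimum of the costs of the finite chains joining `p` to `q`. -/
def chainInf {α : Type*} (ρ : α → α → ℝ≥0∞) (p q : α) : ℝ≥0∞ :=
  ⨅ (k : ℕ) (c : ℕ → α) (_ : c 0 = p) (_ : c k = q), ∑ i ∈ Finset.range k, ρ (c i) (c (i + 1))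

open scoped Classical in
/-- The elementary cost of moving from `p` to `q` in `X_{l+1}`, in terms of the distance `d` of
`X_l`: the distance of the projections within a cover sheet, the jump length for a jump pair, and
infinite otherwise. -/
def stepCost {l : ℕ} (d : Level P l → Level P l → ℝ≥0∞) (p q : Level P (l + 1)) : ℝ≥0∞ :=
  if ∃ σ, p ∈ coverSheet σ ∧ q ∈ coverSheet σ then d p.proj q.proj
  else if IsJumpPair p q then ENNReal.ofReal (P.jumpLen l)
  else ⊤

/-- The distance of `X_l`. -/
def levelDist : (l : ℕ) → Level P l → Level P l → ℝ≥0∞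
  | 0, p, q => edist p.pos q.pos
  | l + 1, p, q => chainInf (stepCost (levelDist l)) p q

/-! ### Basic facts on chains -/

section chain

variable {α : Type*} {ρ : α → α → ℝ≥0∞}

theorem chainInf_le_sum {k : ℕ} (c : ℕ → α) :
    chainInf ρ (c 0) (c k) ≤ ∑ i ∈ Finset.range k, ρ (c i) (c (i + 1)) :=
  iInf_le_of_le k <| iInf_le_of_le c <| iInf_le_of_le rfl <| iInf_le_of_le rfl le_rfl

theorem chainInf_self (p : α) : chainInf ρ p p = 0 := by
  simpa using chainInf_le_sum (ρ := ρ) (k := 0) (fun _ => p)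

theorem chainInf_le (p q : α) : chainInf ρ p q ≤ ρ p q := by
  simpa using chainInf_le_sum (ρ := ρ) (k := 1) (fun i => if i = 0 then p else q)

theorem le_add_chainInf {f : α → ℝ≥0∞} (h : ∀ u v, f u ≤ f v + ρ u v) (p q : α) :
    f p ≤ f q + chainInf ρ p q := by
  have key : ∀ (c : ℕ → α) (k : ℕ),
      f (c 0) ≤ f (c k) + ∑ i ∈ Finset.range k, ρ (c i) (c (i + 1)) := by
    intro c k
    induction k with
    | zero => simp
    | succ k ih =>
      rw [Finset.sum_range_succ]
      calc _ ≤ _ := ih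
        _ ≤ (f (c (k + 1)) + ρ (c k) (c (k + 1))) + _ := by gcongr; exact h _ _
        _ = _ := by ring
  simp only [chainInf, ENNReal.add_iInf]
  refine le_iInf fun k => le_iInf fun c => le_iInf fun h0 => le_iInf fun hk => ?_
  subst h0 hk
  exact key c k

theorem chainInf_triangle (p q r : α) : chainInf ρ p r ≤ chainInf ρ p q + chainInf ρ q r := by
  rw [add_comm]
  refine le_add_chainInf (f := fun u => chainInf ρ u r) (fun u v => ?_) p q
  simp only [chainInf, ENNReal.iInf_add]
  refine le_iInf fun k => le_iInf fun c => le_iInf fun h0 => le_iInf fun hk => ?_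
  subst h0 hk
  have := chainInf_le_sum (ρ := ρ) (k := k + 1) (fun i => Nat.casesOn i u c)
  rw [Finset.sum_range_succ'] at this
  exact this

theorem chainInf_comm (h : ∀ u v, ρ u v = ρ v u) (p q : α) : chainInf ρ p q = chainInf ρ q p := by
  have key : ∀ p q, chainInf ρ q p ≤ chainInf ρ p q := by
    intro p q
    have := le_add_chainInf (ρ := ρ) (f := fun u => chainInf ρ q u) (fun u v => ?_) p q
    · simpa [chainInf_self] using this
    · refine (chainInf_triangle q v u).trans ?_
      rw [h u v]
      gcongr
      exact chainInf_le v u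
  exact le_antisymm (key q p) (key p q)

end chain

/-! ### Arithmetic of the grids -/

variable (P) in
theorem Params.diamParam_ge (l : ℕ) : 100 ≤ P.diamParam l := by
  have := P.n₀_ge
  unfold Params.diamParam; omega

variable (P) in
theorem Params.sub_dvd (l : ℕ) : 3 ∣ P.sub l :=
  P.N_dvd _ (by have := P.diamParam_ge l; omega)

variable (P) in
theorem Params.sub_ge (l : ℕ) : 32 * P.diamParam l ≤ P.sub l := by
  have h := P.diamParam_ge l
  have h1 := (P.N_size (P.diamParam l) (by omega)).2
  have h2 : (100 : ℝ) ≤ P.diamParam l := by exact_mod_cast h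
  rw [one_div_le_one_div (by positivity) (by positivity)] at h1
  unfold Params.sub
  exact_mod_cast h1

variable (P) in
theorem Params.sub_pos (l : ℕ) : 0 < P.sub l := by
  unfold Params.sub; omega

variable (P) in
theorem Params.gridSize_pos (l : ℕ) : 0 < P.gridSize l := by
  induction l with
  | zero => simp [Params.gridSize]
  | succ l ih => exact Nat.mul_pos ih (P.sub_pos l)

variable (P) in
theorem Params.slen_pos (l : ℕ) : 0 < P.slen l := by
  have := P.gridSize_pos l
  unfold Params.slen; positivity

variable (P) in
theorem Params.slen_succ (l : ℕ) : P.slen l = P.sub l * P.slen (l + 1) := by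
  have := P.gridSize_pos l
  have := P.sub_pos l
  simp only [Params.slen, Params.gridSize]
  push_cast
  field_simp

variable (P) in
theorem Params.slen_succ_le (l : ℕ) : P.slen (l + 1) ≤ P.slen l / 2 := by
  have h := P.slen_pos (l + 1)
  have h1 : (2 : ℝ) ≤ P.sub l := by
    have := P.sub_ge l; have := P.diamParam_ge l
    exact_mod_cast (by omega : 2 ≤ P.sub l)
  rw [P.slen_succ l]
  nlinarith

variable (P) in
theorem Params.slen_le_pow (l : ℕ) : P.slen l ≤ (1 / 2) ^ l := by
  induction l with
  | zero => simp [Params.slen, Params.gridSize]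
  | succ l ih => rw [pow_succ]; linarith [P.slen_succ_le l]

variable (P) in
theorem Params.slen_eq_mul {j l : ℕ} (h : j < l) : ∃ R : ℕ, P.slen j = 3 * R * P.slen l := by
  induction l with
  | zero => omega
  | succ l ih =>
    obtain ⟨m, hm⟩ := P.sub_dvd l
    have hs := P.slen_succ l
    rw [hm] at hs
    push_cast at hs
    rcases Nat.lt_succ_iff_lt_or_eq.1 h with h | rfl
    · obtain ⟨R, hR⟩ := ih h
      refine ⟨R * (3 * m), ?_⟩
      rw [hR, hs]; push_cast; ring
    · exact ⟨m, hs⟩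

variable (P) in
theorem Params.jumpLen_pos (l : ℕ) : 0 < P.jumpLen l := by
  have h := P.slen_pos l
  have h2 : (100 : ℝ) ≤ P.diamParam l := by exact_mod_cast P.diamParam_ge l
  unfold Params.jumpLen; positivity

variable (P) in
theorem Params.jumpLen_le (l : ℕ) : P.jumpLen l ≤ P.slen l := by
  have h := P.slen_pos l
  have h2 : (100 : ℝ) ≤ P.diamParam l := by exact_mod_cast P.diamParam_ge l
  unfold Params.jumpLen
  apply div_le_self h.le; linarith

variable (P) in
theorem Params.jumpLen_antitone : Antitone P.jumpLen := by
  refine antitone_nat_of_succ_le fun l => ?_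
  have h := P.slen_pos (l + 1)
  have h1 : (100 : ℝ) ≤ P.diamParam l := by exact_mod_cast P.diamParam_ge l
  have h2 : (100 : ℝ) ≤ P.diamParam (l + 1) := by exact_mod_cast P.diamParam_ge (l + 1)
  have h3 : 32 * (P.diamParam l : ℝ) ≤ P.sub l := by exact_mod_cast P.sub_ge l
  unfold Params.jumpLen
  rw [P.slen_succ l, div_le_div_iff₀ (by positivity) (by positivity)]
  have h4 : (4 * (P.diamParam l : ℝ)) ≤ P.sub l * (4 * P.diamParam (l + 1)) := by nlinarith
  nlinarith

/-- Two subcubes `K` of different levels whose interiors meet are nested. -/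
theorem core_subset_core {j l : ℕ} (h : j < l) {z w : Fin 3 → ℕ} {x : E3}
    (hz : x ∈ core P l z) (hw : x ∈ core P j w) : core P l z ⊆ core P j w := by
  obtain ⟨R, hR⟩ := P.slen_eq_mul h
  have hs := P.slen_pos l
  intro y hy i
  have h1 := abs_lt.1 (hz i)
  have h2 := abs_lt.1 (hw i)
  have h3 := abs_lt.1 (hy i)
  simp only [center, hR] at h1 h2 h3 ⊢
  set s := P.slen l
  have a1 : 3 * R * w i + R < z i + 1 := by
    have : ((3 * R * w i + R : ℝ)) * s < (z i + 1 : ℝ) * s := by nlinarith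
    exact_mod_cast lt_of_mul_lt_mul_right this hs.le
  have a2 : z i < 3 * R * w i + 2 * R := by
    have : (z i : ℝ) * s < (3 * R * w i + 2 * R : ℝ) * s := by nlinarith
    exact_mod_cast lt_of_mul_lt_mul_right this hs.le
  have b1 : (3 * R * w i + R : ℝ) * s ≤ z i * s :=
    mul_le_mul_of_nonneg_right (by exact_mod_cast Nat.lt_succ_iff.1 a1) hs.le
  have b2 : (z i + 1 : ℝ) * s ≤ (3 * R * w i + 2 * R : ℝ) * s :=
    mul_le_mul_of_nonneg_right (by exact_mod_cast a2) hs.le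
  rw [abs_lt]
  constructor <;> nlinarith

theorem center_mem_core (l : ℕ) (z : Fin 3 → ℕ) : center P l z ∈ core P l z := by
  intro i
  have := P.slen_pos l
  simp only [sub_self, abs_zero]; positivity

theorem isOpen_core (l : ℕ) (z : Fin 3 → ℕ) : IsOpen (core P l z) := by
  simp only [core, Set.ofPred_forall]
  exact isOpen_iInter_of_finite fun i => isOpen_lt (by fun_prop) continuous_const

theorem isOpen_doubledRegion (l : ℕ) : IsOpen (doubledRegion P l) :=
  isOpen_biUnion fun z _ => isOpen_core l z

theorem center_mem_cube {l : ℕ} {z : Fin 3 → ℕ} (hz : z ∈ gridCells P l) (i : Fin 3) :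
    center P l z i ∈ Set.Icc (0 : ℝ) 1 := by
  have h1 : (z i : ℝ) + 1 ≤ P.gridSize l := by exact_mod_cast hz i
  have h2 : (0 : ℝ) < P.gridSize l := by exact_mod_cast P.gridSize_pos l
  simp only [center, Params.slen]
  constructor
  · positivity
  · rw [mul_one_div, div_le_one h2]; linarith

theorem edist_core_le {l : ℕ} {z : Fin 3 → ℕ} {x : E3} (hx : x ∈ core P l z) :
    edist x (center P l z) ≤ ENNReal.ofReal (P.slen l) := by
  rw [edist_dist]
  apply ENNReal.ofReal_le_ofReal
  have hs := P.slen_pos l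
  rw [EuclideanSpace.dist_eq, Real.sqrt_le_left hs.le]
  simp only [Real.dist_eq, sq_abs, Fin.sum_univ_three]
  have h := fun i => sq_lt_sq' (abs_lt.1 (hx i)).1 (abs_lt.1 (hx i)).2
  have h0 := h 0
  have h1 := h 1
  have h2 := h 2
  nlinarith

/-! ### Basic facts on the distances -/

theorem Level.mem_core_of_red {l : ℕ} (p : Level P l) {i : Fin l} (h : p.col i = red) :
    ∃ z ∈ toDouble P i, (p.pos : E3) ∈ core P i z := by
  have := p.col_eq_red i h
  simpa [doubledRegion] using this

theorem exists_coverSheet {l : ℕ} {p q : Level P (l + 1)}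
    (h : ∀ z ∈ toDouble P l, (p.pos : E3) ∈ core P l z → (q.pos : E3) ∈ core P l z →
      p.proj.col = q.proj.col → p.lastCol = q.lastCol) :
    ∃ σ, p ∈ coverSheet σ ∧ q ∈ coverSheet σ := by
  classical
  refine ⟨fun a => if a.2 = p.proj.col ∧ (p.pos : E3) ∈ core P l a.1
    then p.lastCol else q.lastCol, ?_, ?_⟩
  · intro z _ hp
    exact (if_pos ⟨rfl, hp⟩).symm
  · intro z hz hq
    dsimp only
    split_ifs with hc
    · exact (h z hz hc.2 hq hc.1.symm).symm
    · rfl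

theorem not_coverSheet {l : ℕ} {p q : Level P (l + 1)} {z : Fin 3 → ℕ} (hz : z ∈ toDouble P l)
    (hp : (p.pos : E3) ∈ core P l z) (hq : (q.pos : E3) ∈ core P l z)
    (h : p.proj.col = q.proj.col) (h' : p.lastCol ≠ q.lastCol) :
    ¬ ∃ σ, p ∈ coverSheet σ ∧ q ∈ coverSheet σ := by
  rintro ⟨σ, h1, h2⟩
  apply h'
  rw [h1 z hz hp, h2 z hz hq, h]

theorem IsJumpPair.symm {l : ℕ} {p q : Level P (l + 1)} (h : IsJumpPair p q) :
    IsJumpPair q p := by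
  obtain ⟨h1, h2, z, hz, h3⟩ := h
  refine ⟨h1.symm, h2.symm, z, hz, ?_⟩
  rw [← h3]
  exact congrArg (fun r : Level P l => (r.pos : E3)) h1.symm

theorem le_stepCost {l : ℕ} {d : Level P l → Level P l → ℝ≥0∞} {p q : Level P (l + 1)} {a : ℝ≥0∞}
    (h1 : (∃ σ, p ∈ coverSheet σ ∧ q ∈ coverSheet σ) → a ≤ d p.proj q.proj)
    (h2 : IsJumpPair p q → a ≤ ENNReal.ofReal (P.jumpLen l)) : a ≤ stepCost d p q := by
  unfold stepCost
  split_ifs with h h'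
  · exact h1 h
  · exact h2 h'
  · exact le_top

theorem stepCost_comm {l : ℕ} {d : Level P l → Level P l → ℝ≥0∞} (hd : ∀ u v, d u v = d v u)
    (p q : Level P (l + 1)) : stepCost d p q = stepCost d q p := by
  have h1 : (∃ σ, p ∈ coverSheet σ ∧ q ∈ coverSheet σ) ↔
      ∃ σ, q ∈ coverSheet σ ∧ p ∈ coverSheet σ := by simp only [and_comm]
  have h2 : IsJumpPair p q ↔ IsJumpPair q p := ⟨fun h => h.symm, fun h => h.symm⟩
  unfold stepCost
  by_cases h : ∃ σ, p ∈ coverSheet σ ∧ q ∈ coverSheet σ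
  · rw [if_pos h, if_pos (h1.1 h), hd]
  · rw [if_neg h, if_neg (mt h1.2 h)]
    by_cases h' : IsJumpPair p q
    · rw [if_pos h', if_pos h'.symm]
    · rw [if_neg h', if_neg (mt h2.2 h')]

theorem levelDist_self {l : ℕ} (p : Level P l) : levelDist l p p = 0 := by
  cases l with
  | zero => simp [levelDist]
  | succ l => exact chainInf_self p

theorem levelDist_comm {l : ℕ} (p q : Level P l) : levelDist l p q = levelDist l q p := by
  induction l with
  | zero => simp [levelDist, edist_comm]
  | succ l ih => exact chainInf_comm (fun u v => stepCost_comm ih u v) p q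

theorem levelDist_triangle {l : ℕ} (p q r : Level P l) :
    levelDist l p r ≤ levelDist l p q + levelDist l q r := by
  cases l with
  | zero => exact edist_triangle _ _ _
  | succ l => exact chainInf_triangle p q r

/-- The projections are `1`-Lipschitz. -/
theorem levelDist_proj_le {l : ℕ} (p q : Level P (l + 1)) :
    levelDist l p.proj q.proj ≤ levelDist (l + 1) p q := by
  have := le_add_chainInf (ρ := stepCost (levelDist l))
    (f := fun u : Level P (l + 1) => levelDist l u.proj q.proj) (fun u v => ?_) p q
  · simp only [levelDist_self, zero_add] at this
    exact this
  · rw [add_comm]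
    refine (levelDist_triangle u.proj v.proj q.proj).trans ?_
    gcongr
    refine le_stepCost (fun _ => le_rfl) fun h => ?_
    rw [h.1, levelDist_self]; exact zero_le

theorem edist_pos_le_levelDist {l : ℕ} (p q : Level P l) :
    edist p.pos q.pos ≤ levelDist l p q := by
  induction l with
  | zero => exact le_rfl
  | succ l ih => exact (ih p.proj q.proj).trans (levelDist_proj_le p q)

/-- Projection is an isometry on cover sheets. -/
theorem levelDist_eq_of_coverSheet {l : ℕ} {p q : Level P (l + 1)}
    (h : ∃ σ, p ∈ coverSheet σ ∧ q ∈ coverSheet σ) :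
    levelDist (l + 1) p q = levelDist l p.proj q.proj := by
  refine le_antisymm ((chainInf_le p q).trans ?_) (levelDist_proj_le p q)
  rw [stepCost, if_pos h]

theorem levelDist_le_edist_of_col_eq {l : ℕ} {p q : Level P l} (h : p.col = q.col) :
    levelDist l p q ≤ edist p.pos q.pos := by
  induction l with
  | zero => exact le_rfl
  | succ l ih =>
    rw [levelDist_eq_of_coverSheet (exists_coverSheet fun _ _ _ _ _ => congrFun h _)]
    exact ih (funext fun i => congrFun h _)

/-- Points with different colours at step `i` over the same doubled subcube are far apart. -/
theorem min_le_levelDist {l : ℕ} {p q : Level P l} {i : Fin l} {z : Fin 3 → ℕ}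
    (hz : z ∈ toDouble P i) (hp : (p.pos : E3) ∈ core P i z) (hq : (q.pos : E3) ∈ core P i z)
    (h : p.col i ≠ q.col i) :
    min (ENNReal.ofReal (P.jumpLen i)) (Metric.infEDist (p.pos : E3) (core P i z)ᶜ)
      ≤ levelDist l p q := by
  classical
  induction l generalizing z with
  | zero => exact i.elim0
  | succ l ih =>
    induction i using Fin.lastCases with
    | cast i => exact (ih (p := p.proj) (q := q.proj) (i := i) hz hp hq h).trans (levelDist_proj_le p q)
    | last =>
      simp only [Fin.val_last] at hz hp hq ⊢
      set J := ENNReal.ofReal (P.jumpLen l)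
      set g : E3 → ℝ≥0∞ := fun x => min J (Metric.infEDist x (core P l z)ᶜ) with hg
      have hgl : ∀ x y, g x ≤ g y + edist x y := by
        intro x y
        simp only [hg]
        rw [min_add]
        exact min_le_min le_self_add Metric.infEDist_le_infEDist_add_edist
      have hg0 : ∀ x, x ∉ core P l z → g x = 0 := by
        intro x hx
        simp only [hg]
        rw [Metric.infEDist_zero_of_mem hx]; simp
      set f : Level P (l + 1) → ℝ≥0∞ := fun u => if u.lastCol = p.lastCol then g u.pos else 0
        with hf
      have hpf : f p = g p.pos := by simp [hf]
      have hqf : f q = 0 := by simp only [hf]; exact if_neg (Ne.symm h)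
      have := le_add_chainInf (ρ := stepCost (levelDist l)) (f := f) (fun u v => ?_) p q
      · rw [hpf, hqf, zero_add] at this; exact this
      · by_cases hu : u.lastCol = p.lastCol
        swap
        · simp [hf, hu]
        have hfu : f u = g u.pos := by simp [hf, hu]
        have hrho : edist u.pos v.pos ≤ stepCost (levelDist l) u v :=
          (edist_pos_le_levelDist u v).trans (chainInf_le u v)
        by_cases hv : v.lastCol = p.lastCol ∨ (v.pos : E3) ∉ core P l z
        · have hfv : f v = g v.pos := by
            rcases hv with hv | hv
            · simp [hf, hv]
            · simp only [hf]; rw [hg0 _ hv]; simp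
          rw [hfu, hfv]
          exact (hgl _ _).trans (add_le_add_right hrho _)
        · push Not at hv
          by_cases huz : (u.pos : E3) ∈ core P l z
          swap
          · rw [hfu, hg0 _ huz]; exact zero_le
          have hfv : f v = 0 := by simp [hf, hv.1]
          rw [hfu, hfv, zero_add]
          have hne : u.lastCol ≠ v.lastCol := by rw [hu]; exact Ne.symm hv.1
          refine le_stepCost (fun hσ => ?_) fun _ => min_le_left _ _
          have hcol : u.proj.col ≠ v.proj.col := fun hc =>
            not_coverSheet hz huz hv.2 hc hne hσ
          obtain ⟨j, hj⟩ := Function.ne_iff.1 hcol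
          have hcore : ∃ w ∈ toDouble P j, (u.pos : E3) ∈ core P j w ∧ (v.pos : E3) ∈ core P j w := by
            rcases hc : u.proj.col j with _ | _
            · have hc' : v.proj.col j = red := by
                rw [hc] at hj; simpa using hj.symm
              obtain ⟨w, hw, hvw⟩ := v.proj.mem_core_of_red hc'
              exact ⟨w, hw, core_subset_core j.2 hv.2 hvw huz, hvw⟩
            · obtain ⟨w, hw, huw⟩ := u.proj.mem_core_of_red hc
              exact ⟨w, hw, huw, core_subset_core j.2 huz huw hv.2⟩
          obtain ⟨w, hw, huw, hvw⟩ := hcore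
          refine le_trans (min_le_min ?_ ?_) (ih (p := u.proj) (q := v.proj) hw huw hvw hj)
          · exact ENNReal.ofReal_le_ofReal (P.jumpLen_antitone j.2.le)
          · apply Metric.infEDist_anti
            exact Set.compl_subset_compl.2 (core_subset_core j.2 huz huw)

theorem levelDist_pos_of_red {l : ℕ} {p : Level P l} {i : Fin l} {z : Fin 3 → ℕ}
    (hp : (p.pos : E3) ∈ core P i z) :
    0 < min (ENNReal.ofReal (P.jumpLen i)) (Metric.infEDist (p.pos : E3) (core P i z)ᶜ) := by
  rw [lt_min_iff]
  refine ⟨by simpa using P.jumpLen_pos i, ?_⟩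
  rw [pos_iff_ne_zero]
  intro h0
  have := (Metric.mem_iff_infEDist_zero_of_closed (isOpen_core (P := P) i z).isClosed_compl).2 h0
  exact this hp

theorem eq_of_levelDist_eq_zero {l : ℕ} {p q : Level P l} (h : levelDist l p q = 0) : p = q := by
  have hpos : p.pos = q.pos := by
    rw [← edist_eq_zero]
    exact le_antisymm (h ▸ edist_pos_le_levelDist p q) zero_le
  refine Level.ext hpos (by_contra fun hne => ?_)
  obtain ⟨i, hi⟩ := Function.ne_iff.1 hne
  have : ∃ z ∈ toDouble P i, (p.pos : E3) ∈ core P i z := by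
    rcases hc : p.col i with _ | _
    · rw [hpos]
      exact q.mem_core_of_red (by rw [hc] at hi; simpa using hi.symm)
    · exact p.mem_core_of_red hc
  obtain ⟨z, hz, hpz⟩ := this
  have h1 := min_le_levelDist hz hpz (hpos ▸ hpz) hi
  rw [h] at h1
  exact absurd (levelDist_pos_of_red hpz) (not_lt.2 h1)

/-- The point of `X_{l+1}` over the centre of a doubled cell, with the colours of a given point over
the same subcube. -/
def centerPoint {l : ℕ} (p : Level P (l + 1)) {z : Fin 3 → ℕ} (hz : z ∈ toDouble P l)
    (hp : (p.pos : E3) ∈ core P l z) : Level P (l + 1) where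
  pos := ⟨center P l z, center_mem_cube hz.1⟩
  col := p.col
  col_eq_red := by
    intro i hi
    have hc := center_mem_core (P := P) l z
    obtain ⟨w, hw, hpw⟩ := p.mem_core_of_red hi
    induction i using Fin.lastCases with
    | cast i =>
      exact Set.mem_biUnion hw (core_subset_core i.2 hp hpw hc)
    | last => exact Set.mem_biUnion hz hc

theorem levelDist_succ_le {l : ℕ} (p q : Level P (l + 1)) :
    levelDist (l + 1) p q ≤ levelDist l p.proj q.proj + ENNReal.ofReal (3 * P.slen l) := by
  by_cases h : ∃ σ, p ∈ coverSheet σ ∧ q ∈ coverSheet σ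
  · rw [levelDist_eq_of_coverSheet h]; exact le_self_add
  · have h' := mt exists_coverSheet h
    push Not at h'
    obtain ⟨z, hz, hp, hq, hcol, hlast⟩ := h'
    refine le_trans ?_ le_add_self
    have hs := (P.slen_pos l).le
    have hJ : levelDist (l + 1) (centerPoint p hz hp) (centerPoint q hz hq)
        ≤ ENNReal.ofReal (P.slen l) := by
      refine (chainInf_le _ _).trans ?_
      have hc := center_mem_core (P := P) l z
      have hn : ¬ ∃ σ, centerPoint p hz hp ∈ coverSheet σ ∧ centerPoint q hz hq ∈ coverSheet σ :=
        not_coverSheet hz hc hc hcol hlast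
      have hj : IsJumpPair (centerPoint p hz hp) (centerPoint q hz hq) :=
        ⟨Level.ext rfl hcol, hlast, z, hz, rfl⟩
      rw [stepCost, if_neg hn, if_pos hj]
      exact ENNReal.ofReal_le_ofReal (P.jumpLen_le l)
    have hP : levelDist (l + 1) p (centerPoint p hz hp) ≤ ENNReal.ofReal (P.slen l) :=
      (levelDist_le_edist_of_col_eq (p := p) (q := centerPoint p hz hp) rfl).trans
        (edist_core_le hp)
    have hQ : levelDist (l + 1) (centerPoint q hz hq) q ≤ ENNReal.ofReal (P.slen l) := by
      rw [levelDist_comm]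
      exact (levelDist_le_edist_of_col_eq (p := q) (q := centerPoint q hz hq) rfl).trans
        (edist_core_le hq)
    calc levelDist (l + 1) p q
        ≤ levelDist (l + 1) p (centerPoint p hz hp) + levelDist (l + 1) (centerPoint p hz hp) q :=
          levelDist_triangle _ _ _
      _ ≤ levelDist (l + 1) p (centerPoint p hz hp) +
          (levelDist (l + 1) (centerPoint p hz hp) (centerPoint q hz hq) +
            levelDist (l + 1) (centerPoint q hz hq) q) := by
          gcongr; exact levelDist_triangle _ _ _
      _ ≤ ENNReal.ofReal (P.slen l) + (ENNReal.ofReal (P.slen l) + ENNReal.ofReal (P.slen l)) := by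
          gcongr
      _ = ENNReal.ofReal (3 * P.slen l) := by
          rw [← ENNReal.ofReal_add hs hs, ← ENNReal.ofReal_add hs (by linarith)]
          congr 1; ring

open scoped Classical in
/-- The point of `X_l` over `x` with colours prescribed by the sequence `c`. For fixed `c` these
points form the chromatic sheet with label `c`. -/
def sheetPoint (l : ℕ) (x : Cube) (c : ℕ → Color) : Level P l where
  pos := x
  col := fun i => c i && decide ((x : E3) ∈ doubledRegion P i)
  col_eq_red := by
    intro i h
    simp at h
    exact h.2

theorem sheetPoint_proj (l : ℕ) (x : Cube) (c : ℕ → Color) :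
    (sheetPoint (P := P) (l + 1) x c).proj = sheetPoint l x c := rfl

/-- Points on sheets whose labels agree up to `m` are close if they have close projections to the
cube. -/
theorem levelDist_sheetPoint_le {m : ℕ} {x y : Cube} {c c' : ℕ → Color}
    (h : ∀ i < m, c i = c' i) (l : ℕ) :
    levelDist (P := P) l (sheetPoint l x c) (sheetPoint l y c')
      ≤ edist x y + ENNReal.ofReal (6 * (1 / 2) ^ m) := by
  have key : levelDist (P := P) l (sheetPoint l x c) (sheetPoint l y c')
      ≤ edist x y + ENNReal.ofReal (6 * (1 / 2) ^ m - 6 * (1 / 2) ^ (max l m)) := by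
    induction l with
    | zero => exact le_self_add
    | succ l ih =>
      rcases lt_or_ge l m with hl | hl
      · rw [max_eq_right (by omega : l + 1 ≤ m)]
        rw [max_eq_right hl.le] at ih
        rw [levelDist_eq_of_coverSheet]
        · exact ih
        · refine exists_coverSheet fun z hz hp hq _ => ?_
          have hx : (x : E3) ∈ doubledRegion P l := Set.mem_biUnion hz hp
          have hy : (y : E3) ∈ doubledRegion P l := Set.mem_biUnion hz hq
          simp [Level.lastCol, sheetPoint, hx, hy, h l hl]
      · rw [max_eq_left (by omega : m ≤ l + 1)]
        rw [max_eq_left hl] at ih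
        refine (levelDist_succ_le _ _).trans ?_
        have h1 : (0 : ℝ) ≤ 6 * (1 / 2) ^ m - 6 * (1 / 2) ^ l := by
          have : ((1 : ℝ) / 2) ^ l ≤ (1 / 2) ^ m :=
            pow_le_pow_of_le_one (by norm_num) (by norm_num) hl
          linarith
        calc _ ≤ (edist x y + ENNReal.ofReal (6 * (1 / 2) ^ m - 6 * (1 / 2) ^ l))
              + ENNReal.ofReal (3 * P.slen l) := by gcongr; exact ih
          _ = edist x y + ENNReal.ofReal (6 * (1 / 2) ^ m - 6 * (1 / 2) ^ l + 3 * P.slen l) := by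
            rw [add_assoc, ← ENNReal.ofReal_add h1 (by linarith [P.slen_pos l])]
          _ ≤ _ := by
            gcongr
            have := P.slen_le_pow l
            rw [pow_succ]; linarith
  refine key.trans ?_
  gcongr
  have : (0 : ℝ) ≤ (1 / 2) ^ (max l m) := by positivity
  linarith

theorem exists_eq_sheetPoint {l : ℕ} (p : Level P l) : ∃ c, p = sheetPoint l p.pos c := by
  refine ⟨fun i => if h : i < l then p.col ⟨i, h⟩ else green, Level.ext rfl (funext fun i => ?_)⟩
  have := p.col_eq_red i
  rcases h : p.col i with _ | _
  · simp [sheetPoint, h]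
  · simp [sheetPoint, h, this h]

theorem levelDist_le {l : ℕ} (p q : Level P l) :
    levelDist l p q ≤ edist p.pos q.pos + ENNReal.ofReal 6 := by
  obtain ⟨c, hc⟩ := exists_eq_sheetPoint p
  obtain ⟨c', hc'⟩ := exists_eq_sheetPoint q
  have := levelDist_sheetPoint_le (P := P) (m := 0) (x := p.pos) (y := q.pos) (c := c) (c' := c')
    (by simp) l
  rw [← hc, ← hc'] at this
  simpa using this

theorem bound_ne_top (x y : Cube) : edist x y + ENNReal.ofReal 6 ≠ ⊤ :=
  ENNReal.add_ne_top.2 ⟨edist_ne_top x y, ENNReal.ofReal_ne_top⟩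

/-! ### The metric measure spaces `X_l` -/

/-- `X_l` with the chain distance is a metric space. -/
instance (l : ℕ) : MetricSpace (Level P l) :=
  letI : EMetricSpace (Level P l) :=
    { edist := levelDist l
      edist_self := levelDist_self
      edist_comm := levelDist_comm
      edist_triangle := levelDist_triangle
      eq_of_edist_eq_zero := eq_of_levelDist_eq_zero }
  EMetricSpace.toMetricSpace fun p q =>
    ne_top_of_le_ne_top (bound_ne_top p.pos q.pos) (levelDist_le p q)

theorem Level.edist_eq {l : ℕ} (p q : Level P l) : edist p q = levelDist l p q := rfl

instance (l : ℕ) : MeasurableSpace (Level P l) := borel _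

instance (l : ℕ) : BorelSpace (Level P l) := ⟨rfl⟩

open scoped Classical in
/-- The lift of a point of `X_l` to `X_{l+1}` with colour `b`; the image is the cover sheet
obtained by always choosing the colour `b`. -/
def Level.lift {l : ℕ} (b : Color) (p : Level P l) : Level P (l + 1) where
  pos := p.pos
  col := Fin.snoc (α := fun _ => Color) p.col (b && decide ((p.pos : E3) ∈ doubledRegion P l))
  col_eq_red := by
    intro i
    induction i using Fin.lastCases with
    | cast i =>
      intro h
      exact p.col_eq_red i (by simpa using h)
    | last =>
      intro h
      simp only [Fin.snoc_last] at h
      simp at h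
      exact h.2

/-- Lebesgue measure on the unit cube. -/
def cubeMeasure : Measure Cube := (volume : Measure E3).comap Subtype.val

/-- The measures `μ_l`: Lebesgue measure on `X_0 = [0,1]³`, and `μ_{l+1}` splits `μ_l` in halves
between the two lifts. -/
def levelMeasure : (l : ℕ) → Measure (Level P l)
  | 0 => cubeMeasure.map fun x => ⟨x, Fin.elim0, fun i => i.elim0⟩
  | l + 1 => (1 / 2 : ℝ≥0∞) • (levelMeasure l).map (Level.lift green) +
      (1 / 2 : ℝ≥0∞) • (levelMeasure l).map (Level.lift red)

/-! ### The inverse limit -/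

variable (P) in
/-- The inverse limit `X_∞`. -/
def LimitSpace : Type := {x : ∀ l, Level P l // ∀ l, (x (l + 1)).proj = x l}

/-- The projection `X_∞ → X_l`. -/
def LimitSpace.proj (l : ℕ) (x : LimitSpace P) : Level P l := x.1 l

/-- The distance of the inverse limit. -/
def limitDist (x y : LimitSpace P) : ℝ≥0∞ :=
  limsup (fun l => levelDist l (x.proj l) (y.proj l)) atTop

theorem levelDist_proj_mono (x y : LimitSpace P) :
    Monotone fun l => levelDist l (x.proj l) (y.proj l) := by
  refine monotone_nat_of_le_succ fun l => ?_
  have := levelDist_proj_le (x.proj (l + 1)) (y.proj (l + 1))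
  rwa [show (x.proj (l + 1)).proj = x.proj l from x.2 l,
    show (y.proj (l + 1)).proj = y.proj l from y.2 l] at this

theorem levelDist_le_limitDist (l : ℕ) (x y : LimitSpace P) :
    levelDist l (x.proj l) (y.proj l) ≤ limitDist x y := by
  refine le_limsup_of_frequently_le ?_
  exact ((eventually_ge_atTop l).mono fun n hn => levelDist_proj_mono x y hn).frequently

theorem limitDist_le {x y : LimitSpace P} {a : ℝ≥0∞}
    (h : ∀ l, levelDist l (x.proj l) (y.proj l) ≤ a) : limitDist x y ≤ a :=
  limsup_le_of_le (h := Eventually.of_forall h)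

theorem LimitSpace.pos_proj (x : LimitSpace P) (l : ℕ) : (x.proj l).pos = (x.proj 0).pos := by
  induction l with
  | zero => rfl
  | succ l ih => rw [← ih, ← show (x.proj (l + 1)).proj = x.proj l from x.2 l]; rfl

/-- `X_∞` is a metric space. -/
instance : MetricSpace (LimitSpace P) :=
  letI : EMetricSpace (LimitSpace P) :=
    { edist := limitDist
      edist_self := fun x => le_antisymm (limitDist_le fun l => (levelDist_self _).le) zero_le
      edist_comm := fun x y => by simp only [limitDist, levelDist_comm]
      edist_triangle := fun x y z => limitDist_le fun l => (levelDist_triangle _ (y.proj l) _).trans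
        (add_le_add (levelDist_le_limitDist l x y) (levelDist_le_limitDist l y z))
      eq_of_edist_eq_zero := fun {x y} h => Subtype.ext <| funext fun l =>
        eq_of_levelDist_eq_zero (le_antisymm ((levelDist_le_limitDist l x y).trans_eq h) zero_le) }
  EMetricSpace.toMetricSpace fun x y =>
    ne_top_of_le_ne_top (bound_ne_top (x.proj 0).pos (y.proj 0).pos) <| limitDist_le fun l => by
      have := levelDist_le (x.proj l) (y.proj l)
      rwa [x.pos_proj, y.pos_proj] at this

theorem LimitSpace.edist_eq (x y : LimitSpace P) : edist x y = limitDist x y := rfl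

instance : MeasurableSpace (LimitSpace P) := borel _

instance : BorelSpace (LimitSpace P) := ⟨rfl⟩

/-- The point of `X_∞` over `x` on the chromatic sheet with label `c`. -/
def limitPoint (x : Cube) (c : ℕ → Color) : LimitSpace P :=
  ⟨fun l => sheetPoint l x c, fun _ => rfl⟩

/-- The uniform probability measure on the two colours. -/
def coin : Measure Color := (1 / 2 : ℝ≥0∞) • Measure.dirac green + (1 / 2 : ℝ≥0∞) • Measure.dirac red

instance : IsProbabilityMeasure coin := ⟨by simp [coin, ENNReal.inv_two_add_inv_two]⟩

variable (P) in
/-- The measure `μ_∞`: the average of the Lebesgue measures of the chromatic sheets of `X_∞` with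
respect to the uniform probability measure on labels. It projects to `μ_l` for each `l`,
see `map_proj_limitMeasure`. -/
def limitMeasure : Measure (LimitSpace P) :=
  (cubeMeasure.prod (Measure.infinitePi fun _ : ℕ => coin)).map
    fun a => limitPoint a.1 a.2

theorem continuous_limitPoint :
    Continuous fun a : Cube × (ℕ → Color) => (limitPoint a.1 a.2 : LimitSpace P) := by
  rw [continuous_iff_continuousAt]
  rintro ⟨x, c⟩
  rw [ContinuousAt, EMetric.tendsto_nhds]
  intro ε hε
  obtain ⟨m, hm⟩ : ∃ m : ℕ, ENNReal.ofReal (6 * (1 / 2) ^ m) < ε / 2 := by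
    have : Tendsto (fun m : ℕ => ENNReal.ofReal (6 * (1 / 2) ^ m)) atTop (𝓝 0) := by
      have h := (tendsto_pow_atTop_nhds_zero_of_lt_one (r := (1 / 2 : ℝ)) (by norm_num)
        (by norm_num)).const_mul 6
      simpa using ENNReal.tendsto_ofReal h
    exact (this.eventually (gt_mem_nhds (ENNReal.half_pos hε.ne'))).exists
  have h1 : ∀ᶠ a : Cube × (ℕ → Color) in 𝓝 (x, c), edist a.1 x < ε / 2 :=
    continuous_fst.tendsto (x, c) (Metric.eball_mem_nhds x (ENNReal.half_pos hε.ne'))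
  have h2 : ∀ᶠ a : Cube × (ℕ → Color) in 𝓝 (x, c), ∀ i ∈ Finset.range m, a.2 i = c i := by
    rw [Filter.eventually_all_finset]
    intro i _
    have : Continuous fun a : Cube × (ℕ → Color) => a.2 i := by fun_prop
    exact (this.tendsto (x, c)).eventually_mem ((isOpen_discrete {c i}).mem_nhds rfl)
  filter_upwards [h1, h2] with a ha1 ha2
  rw [LimitSpace.edist_eq]
  refine lt_of_le_of_lt (limitDist_le fun l => levelDist_sheetPoint_le
    (fun i hi => ha2 i (Finset.mem_range.2 hi)) l) ?_
  calc _ < ε / 2 + ε / 2 := ENNReal.add_lt_add ha1 hm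
    _ = ε := ENNReal.add_halves ε

theorem continuous_proj (l : ℕ) : Continuous (LimitSpace.proj (P := P) l) :=
  (LipschitzWith.of_edist_le fun x y => levelDist_le_limitDist l x y).continuous

theorem continuous_lift {l : ℕ} (b : Color) : Continuous (Level.lift (P := P) (l := l) b) := by
  refine (LipschitzWith.of_edist_le fun p q => ?_).continuous
  have hcol : ∀ p : Level P l, (Level.lift b p).proj = p := fun p =>
    Level.ext rfl (funext fun i => by simp [Level.lift, Level.proj])
  rw [Level.edist_eq, Level.edist_eq, levelDist_eq_of_coverSheet, hcol, hcol]
  refine exists_coverSheet fun z hz hp hq _ => ?_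
  have h1 : (p.pos : E3) ∈ doubledRegion P l := Set.mem_biUnion hz hp
  have h2 : (q.pos : E3) ∈ doubledRegion P l := Set.mem_biUnion hz hq
  simp [Level.lastCol, Level.lift, h1, h2]

theorem sheetPoint_update {l : ℕ} (x : Cube) (c : ℕ → Color) (b : Color) :
    sheetPoint (P := P) (l + 1) x (Function.update c l b) = Level.lift b (sheetPoint l x c) := by
  refine Level.ext rfl (funext fun i => ?_)
  induction i using Fin.lastCases with
  | cast i => simp [sheetPoint, Level.lift, Function.update_of_ne i.2.ne]
  | last =>
    simp only [sheetPoint, Level.lift, Fin.val_last, Function.update_self, Fin.snoc_last]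
    congr

instance : IsProbabilityMeasure cubeMeasure := ⟨by
  have hm : MeasurableSet {x : E3 | ∀ i, x i ∈ Set.Icc (0 : ℝ) 1} := by
    rw [Set.ofPred_forall]
    exact MeasurableSet.iInter fun i => measurableSet_Icc.preimage (by fun_prop)
  have h := (PiLp.volume_preserving_ofLp (Fin 3)).measure_preimage
    (s := Set.univ.pi fun _ => Set.Icc (0 : ℝ) 1)
    (MeasurableSet.univ_pi fun _ => measurableSet_Icc).nullMeasurableSet
  rw [volume_pi_pi] at h
  have h2 : (Subtype.val '' (Set.univ : Set Cube)) =
      (@WithLp.ofLp 2 (Fin 3 → ℝ)) ⁻¹' (Set.univ.pi fun _ => Set.Icc (0 : ℝ) 1) := by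
    ext x; simp [Pi.le_def, forall_and]
  rw [cubeMeasure]
  refine (comap_subtype_coe_apply hm volume Set.univ).trans ?_
  refine (congrArg volume h2).trans ?_
  rw [h]; simp⟩

theorem infinitePi_coin_eq (l : ℕ) :
    (Measure.infinitePi fun _ : ℕ => coin) =
      (1 / 2 : ℝ≥0∞) • (Measure.infinitePi fun _ : ℕ => coin).map
        (fun c => Function.update c l green) +
      (1 / 2 : ℝ≥0∞) • (Measure.infinitePi fun _ : ℕ => coin).map
        (fun c => Function.update c l red) := by
  classical
  symm
  apply Measure.eq_infinitePi
  intro s t ht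
  have hm : MeasurableSet (Set.pi (s : Set ℕ) t) :=
    MeasurableSet.pi s.countable_toSet fun i _ => ht i
  have hu : ∀ b : Color, Measurable fun c : ℕ → Color => Function.update c l b := by
    intro b; fun_prop
  simp only [Measure.add_apply, Measure.smul_apply, smul_eq_mul,
    Measure.map_apply (hu _) hm]
  by_cases hl : l ∈ s
  · have hpre : ∀ b : Color, (fun c : ℕ → Color => Function.update c l b) ⁻¹' (Set.pi (s : Set ℕ) t)
        = if b ∈ t l then Set.pi ((s.erase l : Finset ℕ) : Set ℕ) t else ∅ := by
      intro b
      ext c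
      split_ifs with hb
      · simp only [Set.mem_preimage, Set.mem_pi, Finset.mem_coe, Finset.mem_erase]
        refine ⟨fun h i hi => by simpa [hi.1] using h i hi.2, fun h i hi => ?_⟩
        rcases eq_or_ne i l with rfl | hne
        · simpa using hb
        · simpa [hne] using h i ⟨hne, hi⟩
      · simp only [Set.mem_preimage, Set.mem_pi, Finset.mem_coe, Set.mem_empty_iff_false, iff_false]
        intro h
        exact hb (by simpa using h l hl)
    have hval : ∀ b : Color, (Measure.infinitePi fun _ : ℕ => coin)
        (if b ∈ t l then Set.pi ((s.erase l : Finset ℕ) : Set ℕ) t else ∅)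
          = (t l).indicator 1 b * ∏ i ∈ s.erase l, coin (t i) := by
      intro b
      split_ifs with hb
      · rw [Measure.infinitePi_pi _ fun i _ => ht i]; simp [hb]
      · simp [hb]
    rw [hpre, hpre, hval, hval, ← Finset.mul_prod_erase s _ hl]
    have hcoin : coin (t l) = 1 / 2 * (t l).indicator 1 green + 1 / 2 * (t l).indicator 1 red := by
      simp [coin]
    rw [hcoin]
    ring
  · have hpre : ∀ b : Color, (fun c : ℕ → Color => Function.update c l b) ⁻¹' (Set.pi (s : Set ℕ) t)
        = Set.pi (s : Set ℕ) t := by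
      intro b
      ext c
      simp only [Set.mem_preimage, Set.mem_pi, Finset.mem_coe]
      refine forall₂_congr fun i hi => ?_
      have hne : i ≠ l := fun h => hl (by rwa [h] at hi)
      simp [hne]
    rw [hpre, hpre, Measure.infinitePi_pi _ fun i _ => ht i, ← add_mul]
    simp [ENNReal.inv_two_add_inv_two]

theorem map_sheetPoint (l : ℕ) :
    (cubeMeasure.prod (Measure.infinitePi fun _ : ℕ => coin)).map
      (fun a => (sheetPoint l a.1 a.2 : Level P l)) = levelMeasure l := by
  have hc : ∀ l, Measurable fun a : Cube × (ℕ → Color) => (sheetPoint l a.1 a.2 : Level P l) :=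
    fun l => ((continuous_proj l).comp continuous_limitPoint).measurable
  induction l with
  | zero =>
    have : (fun a : Cube × (ℕ → Color) => (sheetPoint 0 a.1 a.2 : Level P 0)) =
        (fun x => ⟨x, Fin.elim0, fun i => i.elim0⟩) ∘ Prod.fst :=
      funext fun a => Level.ext rfl (funext fun i => i.elim0)
    have hm : Measurable fun x : Cube => (⟨x, Fin.elim0, fun i => i.elim0⟩ : Level P 0) :=
      (LipschitzWith.of_edist_le (f := fun x : Cube =>
        (⟨x, Fin.elim0, fun i => i.elim0⟩ : Level P 0)) fun x y => le_rfl).continuous.measurable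
    rw [this, ← Measure.map_map hm measurable_fst, levelMeasure]
    congr 1
    exact (measurePreserving_fst (μ := cubeMeasure)).map_eq
  | succ l ih =>
    have hu : ∀ b : Color, Measurable fun c : ℕ → Color => Function.update c l b := by
      intro b; fun_prop
    have key : ∀ b : Color, (cubeMeasure.prod ((Measure.infinitePi fun _ : ℕ => coin).map
        (fun c => Function.update c l b))).map
          (fun a => (sheetPoint (l + 1) a.1 a.2 : Level P (l + 1))) =
          (levelMeasure l).map (Level.lift b) := by
      intro b
      have := Measure.map_prod_map cubeMeasure (Measure.infinitePi fun _ : ℕ => coin)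
        measurable_id (hu b)
      rw [Measure.map_id] at this
      rw [this, Measure.map_map (hc _) (measurable_id.prodMap (hu b)), ← ih,
        Measure.map_map (continuous_lift b).measurable (hc l)]
      congr 1
      funext a
      exact sheetPoint_update a.1 a.2 b
    rw [levelMeasure, ← key, ← key]
    conv_lhs => rw [infinitePi_coin_eq l]
    rw [Measure.prod_add, Measure.prod_smul_right, Measure.prod_smul_right,
      Measure.map_add _ _ (hc _), Measure.map_smul, Measure.map_smul]

/-- `μ_∞` projects to `μ_l` for each `l`. -/
theorem map_proj_limitMeasure (l : ℕ) :
    (limitMeasure P).map (LimitSpace.proj l) = levelMeasure l := by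
  rw [limitMeasure, Measure.map_map (continuous_proj l).measurable
    continuous_limitPoint.measurable]
  exact map_sheetPoint l

instance : IsProbabilityMeasure (limitMeasure P) :=
  Measure.isProbabilityMeasure_map continuous_limitPoint.measurable.aemeasurable

/-! ### Tangents -/

/-- The pointed metric space `(Y, q)` is a tangent (blow-up) of `X` at `p`: for some positive
numbers `r n → 0`, the rescaled pointed spaces `((1 / r n) X, p)` converge to `(Y, q)` in the
pointed Gromov–Hausdorff sense. That is, `Y` is complete and for all `R, ε > 0` and all large `n`
there is a map `f` from the `R`-ball of `((1 / r n) X, p)` to `Y` (here extended arbitrarily to `X`)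
with `f p = q` and distortion less than `ε`, such that the `ε`-neighbourhood of the image of the
`R`-ball contains the ball of radius `R - ε` about `q`. -/
def IsTangent {X : Type*} [MetricSpace X] (p : X) {Y : Type*} [MetricSpace Y] (q : Y) : Prop :=
  CompleteSpace Y ∧ ∃ r : ℕ → ℝ, (∀ n, 0 < r n) ∧ Tendsto r atTop (𝓝 0) ∧
    ∀ R > 0, ∀ ε > 0, ∀ᶠ n in atTop, ∃ f : X → Y, f p = q ∧
      (∀ x x', dist x p / r n < R → dist x' p / r n < R →
        |dist (f x) (f x') - dist x x' / r n| < ε) ∧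
      ∀ y, dist y q < R - ε → ∃ x, dist x p / r n < R ∧ dist y (f x) < ε

end NqcDiamond

end

/-!
Jump pairs produce the disconnected tangents. If a cell of side `s = slen l` is doubled with
parameter `n`, then the two lifts of its centre are at distance `J = s / (4 n)`, which is much
smaller than the distance `s / 6` from the centre to the boundary of the doubled subcube, where the
two copies are glued. So in the rescaling by `1 / J` the glueing disappears to infinity as `n → ∞`,
and what remains of the ball of any fixed radius about the centre are two pieces of different
colours at distance at least `1` from each other (`jumpLen_le_dist`). This applies to every point
`p` of the central subcell, whose side is at most `J / 8`, and such a point has a partner of the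
other colour within `3 J` (`exists_mate`).

* A tangent along such scales exists by compactness. Near `p` the colours of the steps before `l`
  are constant (`label_eq_of_dist_lt`), and after boundedly many further steps the fibres are small
  compared to `J`. So the rescaled balls are covered by a bounded number of small sets, and the
  ultralimit of the rescaled spaces is a pointed Gromov–Hausdorff limit along a subsequence
  (`eventually_isApprox`). The colours pass to the limit as a continuous nonconstant function with
  values in a discrete space, so the limit is not connected (`exists_disconnected_tangent`).

* Almost every point lies in the central subcell of a doubled cell at infinitely many levels
  (`ae_frequently_inGate`). At the beginning of a block all cells are doubled, and from there on the
  cell of a point is doubled until the point enters a central subcell. So a point which enters only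
  finitely many of them avoids all central subcells from some level on. The volume of the set of
  such points is at most `∏ (1 - 1 / sub l ^ 3)`, which vanishes because the `n ^ 3` levels of a
  block with parameter `n` contribute at least `1 / 128 ^ 3` to `∑ 1 / sub l ^ 3`.
-/

noncomputable section

namespace NqcDiamond

open MeasureTheory Filter Topology
open scoped ENNReal

/-! ### Limits of real sequences along the hyperfilter -/

theorem exists_tendsto_hyperfilter {u : ℕ → ℝ} {C : ℝ} (h : ∀ m, u m ∈ Set.Icc 0 C) :
    ∃ a, Tendsto u (hyperfilter ℕ) (𝓝 a) := by
  obtain ⟨a, -, ha⟩ := (isCompact_Icc (a := (0 : ℝ)) (b := C)).ultrafilter_le_nhds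
    ((hyperfilter ℕ).map u) (le_principal_iff.2 (Eventually.of_forall h : ∀ᶠ m in _, u m ∈ Set.Icc 0 C))
  exact ⟨a, ha⟩

/-! ### Blow-ups as ultralimits -/

section BlowUp

variable {X : Type} [MetricSpace X] {p : X} {r : ℕ → ℝ}

/-- The sequences in `X` which stay at bounded distance from the base point `p` after rescaling the
metric by `1 / r m`. -/
def BoundedSeq (p : X) (r : ℕ → ℝ) : Type :=
  {x : ℕ → X // ∃ C, ∀ m, dist (x m) p / r m ≤ C}

/-- The constant sequence at the base point. -/
def BoundedSeq.base (p : X) (r : ℕ → ℝ) : BoundedSeq p r :=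
  ⟨fun _ => p, 0, fun m => by simp⟩

theorem BoundedSeq.exists_tendsto (hr : ∀ m, 0 < r m) (x y : BoundedSeq p r) :
    ∃ a, Tendsto (fun m => dist (x.1 m) (y.1 m) / r m) (hyperfilter ℕ) (𝓝 a) := by
  obtain ⟨C, hC⟩ := x.2
  obtain ⟨D, hD⟩ := y.2
  refine exists_tendsto_hyperfilter (C := C + D) fun m =>
    ⟨div_nonneg dist_nonneg (hr m).le, ?_⟩
  calc _ ≤ (dist (x.1 m) p + dist (y.1 m) p) / r m := by
        have := (hr m).le
        gcongr
        exact dist_triangle_right _ _ _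
    _ ≤ C + D := by rw [add_div]; exact add_le_add (hC m) (hD m)

/-- The pseudometric on bounded sequences given by the limit of the rescaled distances along the
hyperfilter. -/
@[reducible]
def BoundedSeq.pseudoMetricSpace (hr : ∀ m, 0 < r m) : PseudoMetricSpace (BoundedSeq p r) where
  dist x y := limUnder (hyperfilter ℕ : Filter ℕ) fun m => dist (x.1 m) (y.1 m) / r m
  dist_self x := by
    refine Tendsto.limUnder_eq ?_
    simp
  dist_comm x y := by simp only [dist_comm]
  dist_triangle x y z := by
    have h := fun u v : BoundedSeq p r => tendsto_nhds_limUnder (exists_tendsto hr u v)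
    refine le_of_tendsto_of_tendsto' (h x z) ((h x y).add (h y z)) fun m => ?_
    rw [← add_div]
    have := (hr m).le
    gcongr
    exact dist_triangle _ _ _

theorem BoundedSeq.tendsto_dist (hr : ∀ m, 0 < r m) (x y : BoundedSeq p r) :
    letI := pseudoMetricSpace (p := p) hr
    Tendsto (fun m => dist (x.1 m) (y.1 m) / r m) (hyperfilter ℕ) (𝓝 (dist x y)) :=
  tendsto_nhds_limUnder (exists_tendsto hr x y)

/-- Uniform total boundedness of the rescaled balls about `p`, in terms of colourings: the ball of
radius `R` can be coloured by a finite set not depending on `m` in such a way that points of equal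
colour are `ε`-close. -/
def UniformlyTotallyBounded (p : X) (r : ℕ → ℝ) : Prop :=
  ∀ R > 0, ∀ ε > 0, ∃ (F : Type) (_ : Finite F) (Φ : ℕ → X → F), ∀ᶠ m in atTop, ∀ x y,
    dist x p / r m < R → dist y p / r m < R → Φ m x = Φ m y → dist x y / r m ≤ ε

/-- The approximation required in `IsTangent`, for given radius `R` and precision `ε`, between `X`
rescaled by `1 / s` and `(Y, q)`. -/
def IsApprox {Y : Type*} [MetricSpace Y] (p : X) (s : ℝ) (q : Y) (R ε : ℝ) : Prop :=
  ∃ f : X → Y, f p = q ∧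
    (∀ x x', dist x p / s < R → dist x' p / s < R → |dist (f x) (f x') - dist x x' / s| < ε) ∧
    ∀ y, dist y q < R - ε → ∃ x, dist x p / s < R ∧ dist y (f x) < ε

/-- Approximation on a large ball restricts to smaller balls. The factor `2` makes up for the
distortion of the distance to the base point. -/
theorem IsApprox.mono {Y : Type*} [MetricSpace Y] {s : ℝ} {q : Y} {R R' ε ε' : ℝ}
    (h : IsApprox p s q R ε) (hR : R' ≤ R) (h0 : 0 < R) (hε : 2 * ε ≤ ε') (hε0 : 0 < ε) :
    IsApprox p s q R' ε' := by
  obtain ⟨f, hfp, hf, hf'⟩ := h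
  refine ⟨f, hfp, fun x x' hx hx' => (hf x x' (by linarith) (by linarith)).trans_le (by linarith),
    fun y hy => ?_⟩
  obtain ⟨x, hx, hyx⟩ := hf' y (by linarith)
  refine ⟨x, ?_, by linarith⟩
  have h1 := abs_lt.1 (hf x p hx (by simpa using h0))
  rw [hfp] at h1
  have h2 := dist_triangle_left (f x) q y
  linarith

/-- Under uniform total boundedness the ultralimit of the rescaled spaces is approximated by them
for most indices, in the sense of the hyperfilter. -/
theorem eventually_isApprox (hr : ∀ m, 0 < r m) (hcov : UniformlyTotallyBounded p r)
    {R ε : ℝ} (hR : 0 < R) (hε : 0 < ε) :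
    letI := BoundedSeq.pseudoMetricSpace (p := p) hr
    ∀ᶠ m in (hyperfilter ℕ : Filter ℕ),
      IsApprox p (r m) (BoundedSeq.base p r : UniformSpace.Completion (BoundedSeq p r)) R ε := by
  classical
  let _ := BoundedSeq.pseudoMetricSpace (p := p) hr
  obtain ⟨δ, hδ, hδε⟩ : ∃ δ > 0, 5 * δ = ε := ⟨ε / 5, by positivity, by ring⟩
  obtain ⟨F, _, Φ, hΦ⟩ := hcov R hR δ hδ
  replace hΦ := (Nat.hyperfilter_le_atTop) hΦ
  -- representatives of the colours, and the base point
  let ρ₀ : Option F → ℕ → X := fun a m => a.elim p fun a =>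
    if h : ∃ x, dist x p / r m < R ∧ Φ m x = a then h.choose else p
  have hρR : ∀ a m, dist (ρ₀ a m) p / r m < R := by
    intro a m
    rcases a with _ | a
    · simpa [ρ₀] using hR
    · simp only [ρ₀, Option.elim]
      split_ifs with h
      · exact h.choose_spec.1
      · simpa using hR
  have hρΦ : ∀ m x, dist x p / r m < R → Φ m (ρ₀ (some (Φ m x)) m) = Φ m x := by
    intro m x hx
    have h : ∃ y, dist y p / r m < R ∧ Φ m y = Φ m x := ⟨x, hx, rfl⟩
    simp only [ρ₀, Option.elim, dif_pos h]
    exact h.choose_spec.2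
  let ρ : Option F → BoundedSeq p r := fun a => ⟨ρ₀ a, R, fun m => (hρR a m).le⟩
  have hρnone : ρ none = BoundedSeq.base p r := rfl
  have hnear : ∀ᶠ m in (hyperfilter ℕ : Filter ℕ), ∀ x, dist x p / r m < R →
      dist x (ρ₀ (some (Φ m x)) m) / r m ≤ δ := by
    filter_upwards [hΦ] with m hm x hx
    exact hm _ _ hx (hρR _ _) (hρΦ m x hx).symm
  have hdist : ∀ᶠ m in (hyperfilter ℕ : Filter ℕ), ∀ a b,
      |dist (ρ₀ a m) (ρ₀ b m) / r m - dist (ρ a) (ρ b)| < δ := by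
    refine eventually_all.2 fun a => eventually_all.2 fun b => ?_
    exact (Metric.tendsto_nhds.1 (BoundedSeq.tendsto_dist hr (ρ a) (ρ b)) δ hδ)
  -- every point of the limit ball is near a limit of representatives, by finiteness of `F`
  have hdense : ∀ i : BoundedSeq p r, dist i (BoundedSeq.base p r) < R →
      ∃ a, dist i (ρ a) ≤ δ := by
    intro i hi
    by_contra! hcon
    have h1 : ∀ᶠ m in (hyperfilter ℕ : Filter ℕ), ∀ a, δ < dist (i.1 m) (ρ₀ a m) / r m :=
      eventually_all.2 fun a => (BoundedSeq.tendsto_dist hr i (ρ a)).eventually_const_lt (hcon a)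
    have h2 := (BoundedSeq.tendsto_dist hr i (BoundedSeq.base p r)).eventually_lt_const hi
    obtain ⟨m, hm1, hm2, hm3⟩ := (h1.and (h2.and hnear)).exists
    exact absurd (hm3 _ hm2) (not_le.2 (hm1 _))
  filter_upwards [hnear, hdist] with m hm1 hm2
  -- the approximation sends `x` to the limit of the representatives of its colour
  let idx : X → Option F := fun x => if x = p then none else some (Φ m x)
  have hidx : ∀ x, dist x p / r m < R → dist x (ρ₀ (idx x) m) / r m ≤ δ := by
    intro x hx
    by_cases h : x = p
    · simpa [idx, h, ρ₀] using hδ.le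
    · simpa [idx, h] using hm1 x hx
  have hclose : ∀ x a, dist x p / r m < R →
      |dist (ρ (idx x)) (ρ a) - dist x (ρ₀ a m) / r m| < 2 * δ := by
    intro x a hx
    have h1 := abs_lt.1 (hm2 (idx x) a)
    have h2 := hidx x hx
    have h3 : dist x (ρ₀ a m) / r m ≤
        dist x (ρ₀ (idx x) m) / r m + dist (ρ₀ (idx x) m) (ρ₀ a m) / r m := by
      rw [← add_div]
      exact div_le_div_of_nonneg_right (dist_triangle _ _ _) (hr m).le
    have h4 : dist (ρ₀ (idx x) m) (ρ₀ a m) / r m ≤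
        dist x (ρ₀ (idx x) m) / r m + dist x (ρ₀ a m) / r m := by
      rw [← add_div]
      exact div_le_div_of_nonneg_right (dist_triangle_left _ _ _) (hr m).le
    rw [abs_lt]
    constructor <;> linarith
  refine ⟨fun x => (ρ (idx x) : BoundedSeq p r), ?_, fun x x' hx hx' => ?_, fun y hy => ?_⟩
  · simp [idx, hρnone]
  · rw [UniformSpace.Completion.dist_eq]
    have h1 := abs_lt.1 (hclose x (idx x') hx)
    have h2 := hidx x' hx'
    have h3 : dist x (ρ₀ (idx x') m) / r m ≤
        dist x x' / r m + dist x' (ρ₀ (idx x') m) / r m := by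
      rw [← add_div]
      exact div_le_div_of_nonneg_right (dist_triangle _ _ _) (hr m).le
    have h4 : dist x x' / r m ≤
        dist x (ρ₀ (idx x') m) / r m + dist x' (ρ₀ (idx x') m) / r m := by
      rw [← add_div]
      exact div_le_div_of_nonneg_right (dist_triangle_right _ _ _) (hr m).le
    rw [abs_lt]
    constructor <;> linarith
  · obtain ⟨i, hi⟩ : ∃ i : BoundedSeq p r, dist y i < δ := by
      exact UniformSpace.Completion.denseRange_coe.exists_dist_lt y hδ
    obtain ⟨a, ha⟩ := hdense i (by
      rw [← UniformSpace.Completion.dist_eq]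
      have := dist_triangle_left (i : UniformSpace.Completion (BoundedSeq p r))
        (BoundedSeq.base p r : BoundedSeq p r) y
      linarith)
    refine ⟨ρ₀ a m, hρR a m, ?_⟩
    have h1 := abs_lt.1 (hclose (ρ₀ a m) a (hρR a m))
    rw [dist_self, zero_div] at h1
    have h2 := dist_triangle4_right y (ρ (idx (ρ₀ a m)) : UniformSpace.Completion (BoundedSeq p r))
      (i : UniformSpace.Completion (BoundedSeq p r)) (ρ a : BoundedSeq p r)
    simp only [UniformSpace.Completion.dist_eq] at h2
    linarith

/-- If the rescaled spaces are uniformly totally bounded about `p`, and if their bounded parts split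
into two pieces at distance at least `1` which are both met by a fixed ball, then `X` has a
disconnected tangent at `p`. -/
theorem exists_disconnected_tangent (hr : ∀ m, 0 < r m) (hr0 : Tendsto r atTop (𝓝 0))
    (hcov : UniformlyTotallyBounded p r) (κ : ℕ → X → Bool)
    (hκ : ∀ R, ∀ᶠ m in atTop, ∀ x y, dist x p / r m < R → dist y p / r m < R →
      κ m x ≠ κ m y → 1 ≤ dist x y / r m)
    {C : ℝ} (p' : ℕ → X) (hp' : ∀ m, dist (p' m) p / r m ≤ C) (hp'κ : ∀ m, κ m (p' m) ≠ κ m p) :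
    ∃ (Y : Type) (_ : MetricSpace Y) (q : Y), IsTangent p q ∧ ¬ ConnectedSpace Y := by
  classical
  let _ := BoundedSeq.pseudoMetricSpace (p := p) hr
  refine ⟨UniformSpace.Completion (BoundedSeq p r), inferInstance,
    (BoundedSeq.base p r : BoundedSeq p r), ⟨inferInstance, ?_⟩, fun hconn => ?_⟩
  · have hfreq : ∀ j : ℕ, ∃ᶠ m in atTop, IsApprox p (r m)
        (BoundedSeq.base p r : UniformSpace.Completion (BoundedSeq p r)) (j + 1) (1 / (j + 1)) :=
      fun j => (eventually_isApprox hr hcov (by positivity) (by positivity)).frequently.filter_mono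
        Nat.hyperfilter_le_atTop
    obtain ⟨φ, hφ, h⟩ := extraction_forall_of_frequently hfreq
    refine ⟨r ∘ φ, fun n => hr _, hr0.comp hφ.tendsto_atTop, fun R hR ε hε => ?_⟩
    have h1 : ∀ᶠ j : ℕ in atTop, R ≤ j + 1 :=
      (tendsto_natCast_atTop_atTop.eventually_ge_atTop R).mono fun j hj => by linarith
    have h2 : ∀ᶠ j : ℕ in atTop, 1 / ((j : ℝ) + 1) < ε / 2 :=
      tendsto_one_div_add_atTop_nhds_zero_nat.eventually_lt_const (by positivity)
    filter_upwards [h1, h2] with j hj1 hj2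
    exact (h j).mono hj1 (by positivity) (by linarith) (by positivity)
  · -- the colour of a bounded sequence is its colour at most indices
    let g : BoundedSeq p r → Bool := fun x =>
      decide (∀ᶠ m in (hyperfilter ℕ : Filter ℕ), κ m (x.1 m) = true)
    have hg : ∀ x y : BoundedSeq p r, dist x y < 1 → g x = g y := by
      intro x y hxy
      obtain ⟨A, hA⟩ := x.2
      obtain ⟨B, hB⟩ := y.2
      have h1 := (BoundedSeq.tendsto_dist hr x y).eventually_lt_const hxy
      have h2 : ∀ᶠ m in (hyperfilter ℕ : Filter ℕ), κ m (x.1 m) = κ m (y.1 m) := by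
        filter_upwards [h1, Nat.hyperfilter_le_atTop (hκ (max A B + 1))] with m hm1 hm2
        by_contra hne
        have := hm2 (x.1 m) (y.1 m) ((hA m).trans_lt (by linarith [le_max_left A B]))
          ((hB m).trans_lt (by linarith [le_max_right A B])) hne
        linarith
      simp only [g, decide_eq_decide]
      exact eventually_congr (h2.mono fun m hm => by rw [hm])
    have hguc : UniformContinuous g := by
      rw [Metric.uniformity_basis_dist.uniformContinuous_iff
        (DiscreteUniformity.eq_principal_setRelId Bool ▸ hasBasis_principal _)]
      exact fun _ _ => ⟨1, one_pos, fun x y hxy => hg x y hxy⟩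
    let q' : BoundedSeq p r := ⟨p', C, hp'⟩
    have hconst := PreconnectedSpace.constant hconn.toPreconnectedSpace
      (UniformSpace.Completion.continuous_extension (f := g))
      (x := ((BoundedSeq.base p r : BoundedSeq p r) : UniformSpace.Completion (BoundedSeq p r)))
      (y := (q' : UniformSpace.Completion (BoundedSeq p r)))
    rw [UniformSpace.Completion.extension_coe hguc, UniformSpace.Completion.extension_coe hguc]
      at hconst
    simp only [g, decide_eq_decide, BoundedSeq.base, q'] at hconst
    have hnot : ∀ m, κ m (p' m) = true ↔ ¬ κ m p = true := by
      intro m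
      have := hp'κ m
      cases h : κ m (p' m) <;> cases h' : κ m p <;> simp_all
    simp only [hnot, Ultrafilter.eventually_not] at hconst
    exact iff_not_self hconst

end BlowUp

/-! ### Parameters -/

namespace Params

variable (P : Params)

theorem nbar_succ (k : ℕ) : P.nbar (k + 1) = P.nbar k + (P.n₀ + (k + 1)) ^ 3 :=
  Finset.sum_Icc_succ_top (by omega) _

theorem nbar_mono : Monotone P.nbar :=
  monotone_nat_of_le_succ fun k => by rw [nbar_succ]; omega

theorem le_nbar (k : ℕ) : k ≤ P.nbar k := by
  induction k with
  | zero => omega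
  | succ k ih =>
    have : 0 < (P.n₀ + (k + 1)) ^ 3 := by positivity
    rw [nbar_succ]; omega

theorem le_block {k l : ℕ} (h : P.nbar k ≤ l) : k ≤ P.block l := by
  have hmem : P.block l ∈ {k | l < P.nbar (k + 1)} :=
    Nat.sInf_mem ⟨l, (P.le_nbar (l + 1))⟩
  by_contra! hlt
  have := P.nbar_mono (show P.block l + 1 ≤ k from hlt)
  have : l < P.nbar (P.block l + 1) := hmem
  omega

theorem block_eq {k l : ℕ} (h : P.nbar k ≤ l) (h' : l < P.nbar (k + 1)) : P.block l = k :=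
  le_antisymm (Nat.sInf_le h') (P.le_block h)

theorem tendsto_diamParam : Tendsto P.diamParam atTop atTop := by
  refine tendsto_atTop.2 fun k => ?_
  filter_upwards [eventually_ge_atTop (P.nbar k)] with l hl
  have := P.le_block hl
  unfold diamParam; omega

theorem slen_succ_le_jumpLen (l : ℕ) : 8 * P.slen (l + 1) ≤ P.jumpLen l := by
  have h1 : (100 : ℝ) ≤ P.diamParam l := by exact_mod_cast P.diamParam_ge l
  have h3 : 32 * (P.diamParam l : ℝ) ≤ P.sub l := by exact_mod_cast P.sub_ge l
  unfold jumpLen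
  rw [P.slen_succ l, le_div_iff₀ (by positivity)]
  nlinarith [P.slen_pos (l + 1)]

theorem slen_eq_jumpLen (l : ℕ) : P.slen l = 4 * P.diamParam l * P.jumpLen l := by
  have h1 : (100 : ℝ) ≤ P.diamParam l := by exact_mod_cast P.diamParam_ge l
  unfold jumpLen
  field_simp

theorem slen_antitone : Antitone P.slen :=
  antitone_nat_of_succ_le fun l => by linarith [P.slen_succ_le l, P.slen_pos l]

theorem slen_add_le (l t : ℕ) : P.slen (l + t) ≤ (1 / 2) ^ t * P.slen l := by
  induction t with
  | zero => simp
  | succ t ih => rw [pow_succ, ← add_assoc]; linarith [P.slen_succ_le (l + t)]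

theorem tendsto_jumpLen : Tendsto P.jumpLen atTop (𝓝 0) :=
  squeeze_zero (fun l => (P.jumpLen_pos l).le) (fun l => (P.jumpLen_le l).trans (P.slen_le_pow l))
    (tendsto_pow_atTop_nhds_zero_of_lt_one (by norm_num) (by norm_num))

end Params

/-! ### Distances in the limit space -/

variable {P : Params}

namespace LimitSpace

/-- The position in the unit cube of a point of `X_∞`. -/
def pos (x : LimitSpace P) : Cube := (x.proj 0).pos

/-- The colour of a point of `X_∞` at step `i`. -/
def label (x : LimitSpace P) (i : ℕ) : Color := (x.proj (i + 1)).lastCol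

theorem proj_pos (x : LimitSpace P) (l : ℕ) : (x.proj l).pos = x.pos := x.pos_proj l

theorem proj_col (x : LimitSpace P) (l : ℕ) (i : Fin l) : (x.proj l).col i = x.label i := by
  induction l with
  | zero => exact i.elim0
  | succ l ih =>
    induction i using Fin.lastCases with
    | cast i => rw [Fin.val_castSucc, ← ih i, ← show (x.proj (l + 1)).proj = x.proj l from x.2 l]; rfl
    | last => rfl

theorem exists_core_of_red {x : LimitSpace P} {i : ℕ} (h : x.label i = red) :
    ∃ w ∈ toDouble P i, (x.pos : E3) ∈ core P i w := by
  have := (x.proj (i + 1)).mem_core_of_red (i := Fin.last i) h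
  rwa [x.proj_pos] at this

theorem dist_pos_le (x y : LimitSpace P) : dist x.pos y.pos ≤ dist x y := by
  rw [← ENNReal.ofReal_le_ofReal_iff dist_nonneg, ← edist_dist, ← edist_dist]
  exact (edist_pos_le_levelDist _ _).trans (levelDist_le_limitDist 0 x y)

/-- The fibres of `X_∞ → X_t` have diameter at most `6 * slen t`, and passing from `X_t` to `X_∞`
increases distances by at most that much. -/
theorem edist_le_levelDist_add (x y : LimitSpace P) (t : ℕ) :
    edist x y ≤ levelDist t (x.proj t) (y.proj t) + ENNReal.ofReal (6 * P.slen t) := by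
  have key : ∀ k, levelDist (t + k) (x.proj (t + k)) (y.proj (t + k)) ≤
      levelDist t (x.proj t) (y.proj t) +
        ENNReal.ofReal (6 * P.slen t - 6 * P.slen (t + k)) := by
    intro k
    induction k with
    | zero => simp
    | succ k ih =>
      have h := levelDist_succ_le (x.proj (t + k + 1)) (y.proj (t + k + 1))
      rw [show (x.proj (t + k + 1)).proj = x.proj (t + k) from x.2 _,
        show (y.proj (t + k + 1)).proj = y.proj (t + k) from y.2 _] at h
      refine h.trans ((add_le_add_left ih _).trans ?_)
      rw [add_assoc, ← ENNReal.ofReal_add]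
      · gcongr
        rw [← add_assoc]
        linarith [P.slen_succ_le (t + k)]
      · linarith [P.slen_antitone (Nat.le_add_right t k)]
      · linarith [P.slen_pos (t + k)]
  refine limitDist_le fun l => ?_
  rcases le_total l t with h | h
  · exact (levelDist_proj_mono x y h).trans le_self_add
  · obtain ⟨k, rfl⟩ := Nat.exists_eq_add_of_le h
    refine (key k).trans ?_
    gcongr
    linarith [P.slen_pos (t + k)]

theorem dist_le_of_label_eq {x y : LimitSpace P} {t : ℕ} (h : ∀ i < t, x.label i = y.label i) :
    dist x y ≤ dist x.pos y.pos + 6 * P.slen t := by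
  have hs := P.slen_pos t
  rw [← ENNReal.ofReal_le_ofReal_iff (by positivity), ENNReal.ofReal_add dist_nonneg
    (by positivity), ← edist_dist, ← edist_dist]
  refine (edist_le_levelDist_add x y t).trans ?_
  gcongr
  have := levelDist_le_edist_of_col_eq (p := x.proj t) (q := y.proj t)
    (funext fun i => by rw [proj_col, proj_col, h i i.2])
  rwa [proj_pos, proj_pos] at this

/-- Points of different colours at step `i` in the same doubled subcube are at distance at least
`a`, provided that `a` is at most the jump length and one of the points has distance at least `a`
from the boundary of the subcube. -/
theorem le_dist_of_label_ne {x y : LimitSpace P} {i : ℕ} {w : Fin 3 → ℕ} {a : ℝ}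
    (hw : w ∈ toDouble P i) (hx : (x.pos : E3) ∈ core P i w) (hy : (y.pos : E3) ∈ core P i w)
    (hne : x.label i ≠ y.label i) (ha : a ≤ P.jumpLen i)
    (hball : ∀ u : E3, dist u x.pos < a → u ∈ core P i w) : a ≤ dist x y := by
  have h := (min_le_levelDist (p := x.proj (i + 1)) (q := y.proj (i + 1)) (i := Fin.last i) hw
    (by rwa [proj_pos]) (by rwa [proj_pos]) hne).trans (levelDist_le_limitDist (i + 1) x y)
  rw [← edist_eq, edist_dist, proj_pos] at h
  rw [← ENNReal.ofReal_le_ofReal_iff dist_nonneg]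
  refine le_trans (le_min (ENNReal.ofReal_le_ofReal ha) (Metric.le_infEDist.2 fun u hu => ?_)) h
  rw [edist_dist]
  refine ENNReal.ofReal_le_ofReal (le_of_not_gt fun hlt => hu (hball u ?_))
  rwa [dist_comm]

end LimitSpace

/-! ### Points in the central cell of a diamond -/

/-- `x` lies in the central subcell, of side `slen (l + 1)`, of a cell that is doubled at
level `l`. -/
def InGate (P : Params) (l : ℕ) (x : E3) : Prop :=
  ∃ z ∈ toDouble P l, ∀ i, |x i - center P l z i| ≤ P.slen (l + 1) / 2

section gate

variable {p : LimitSpace P} {l : ℕ} {z : Fin 3 → ℕ}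

/-- In units of the jump length, the boundary of the doubled subcube is far away from the points of
the central cell, since `slen l = 4 * n * jumpLen l` with large `n`. -/
theorem mem_core_of_dist_lt {x y : E3} {R : ℝ}
    (hx : ∀ i, |x i - center P l z i| ≤ P.slen (l + 1) / 2)
    (hR : 2 * R + 2 ≤ P.diamParam l) (hy : dist y x < R * P.jumpLen l) : y ∈ core P l z := by
  intro i
  have h1 : |y i - x i| ≤ dist y x := by
    rw [← Real.dist_eq]; exact PiLp.dist_apply_le y x i
  have h2 := abs_sub_le (y i) (x i) (center P l z i)
  have h3 := P.slen_succ_le_jumpLen l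
  have h4 := P.slen_eq_jumpLen l
  have h5 := P.jumpLen_pos l
  have h6 := hx i
  nlinarith

variable (hz : z ∈ toDouble P l)
  (hp : ∀ i, |(p.pos : E3) i - center P l z i| ≤ P.slen (l + 1) / 2)

include hp in
theorem pos_mem_core_of_dist_lt {x : LimitSpace P} {R : ℝ} (hR : 2 * R + 2 ≤ P.diamParam l)
    (hx : dist x p < R * P.jumpLen l) : (x.pos : E3) ∈ core P l z :=
  mem_core_of_dist_lt hp hR ((LimitSpace.dist_pos_le x p).trans_lt hx)

include hp in
theorem pos_mem_core : (p.pos : E3) ∈ core P l z := by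
  have := P.diamParam_ge l
  refine pos_mem_core_of_dist_lt (R := 1) hp ?_ (by simpa using P.jumpLen_pos l)
  norm_num
  exact_mod_cast (by omega : 4 ≤ P.diamParam l)

include hp in
/-- Near a point of a central cell all earlier colours are constant. -/
theorem label_eq_of_dist_lt {x : LimitSpace P} {R : ℝ} (hR : 2 * R + 2 ≤ P.diamParam l)
    (hx : dist x p < R * P.jumpLen l) {i : ℕ} (hi : i < l) : x.label i = p.label i := by
  by_contra hne
  have hpz := pos_mem_core hp
  have hxz := pos_mem_core_of_dist_lt hp hR hx
  obtain ⟨w, hw, hzw⟩ : ∃ w ∈ toDouble P i, core P l z ⊆ core P i w := by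
    rcases hc : p.label i with _ | _
    · obtain ⟨w, hw, hxw⟩ := LimitSpace.exists_core_of_red (x := x) (i := i)
        (by rw [hc] at hne; simpa using hne)
      exact ⟨w, hw, core_subset_core hi hxz hxw⟩
    · obtain ⟨w, hw, hpw⟩ := LimitSpace.exists_core_of_red hc
      exact ⟨w, hw, core_subset_core hi hpz hpw⟩
  -- the jumps of earlier steps are longer than the whole doubled subcube
  have hJ : R * P.jumpLen l ≤ P.jumpLen i := by
    have h1 := P.slen_succ_le_jumpLen i
    have h2 := P.slen_antitone (show i + 1 ≤ l from hi)
    have h3 := P.slen_eq_jumpLen l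
    have h4 := P.jumpLen_pos l
    have h5 := P.slen_pos l
    nlinarith
  have := LimitSpace.le_dist_of_label_ne hw (hzw hpz) (hzw hxz) (Ne.symm hne) hJ
    fun u hu => hzw (mem_core_of_dist_lt hp hR hu)
  rw [dist_comm] at this
  linarith

include hz hp in
/-- Near a point of a central cell, the two colours of the diamond are separated by the jump. -/
theorem jumpLen_le_dist {x y : LimitSpace P} {R : ℝ} (hR : 2 * R + 4 ≤ P.diamParam l)
    (hx : dist x p < R * P.jumpLen l) (hy : dist y p < R * P.jumpLen l)
    (hne : x.label l ≠ y.label l) : P.jumpLen l ≤ dist x y := by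
  refine LimitSpace.le_dist_of_label_ne hz (pos_mem_core_of_dist_lt hp (by linarith) hx)
    (pos_mem_core_of_dist_lt hp (by linarith) hy) hne le_rfl fun u hu => ?_
  refine mem_core_of_dist_lt (R := R + 1) hp (by linarith) ?_
  have h1 := LimitSpace.dist_pos_le x p
  have h2 := dist_triangle u (x.pos : E3) p.pos
  rw [Subtype.dist_eq] at h1
  linarith

theorem label_limitPoint (x : Cube) (c : ℕ → Color) (i : ℕ) :
    (limitPoint x c : LimitSpace P).label i = true ↔
      c i = true ∧ (x : E3) ∈ doubledRegion P i := by
  simp [LimitSpace.label, limitPoint, LimitSpace.proj, Level.lastCol, sheetPoint]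

include hz hp in
/-- Near a point of a central cell there is a point across the jump: the lift of the centre with the
other colour. -/
theorem exists_mate : ∃ p' : LimitSpace P,
    dist p' p ≤ 3 * P.jumpLen l ∧ p'.label l ≠ p.label l := by
  -- the centre of the diamond, and the colours of `p` changed at step `l`
  set c₀ : Cube := ⟨center P l z, center_mem_cube hz.1⟩ with hc₀
  set c' : ℕ → Color := Function.update p.label l (!p.label l) with hc'
  have hcz : (c₀ : E3) ∈ doubledRegion P l := Set.mem_biUnion hz (center_mem_core l z)
  have hs := P.slen_succ_le_jumpLen l
  have hs0 := P.slen_pos (l + 1)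
  have hJ0 := P.jumpLen_pos l
  refine ⟨limitPoint c₀ c', ?_, fun h => ?_⟩
  · have h1 : dist p (limitPoint c₀ p.label) ≤ 7 * P.slen (l + 1) := by
      refine (LimitSpace.dist_le_of_label_eq (t := l + 1) fun i hi => ?_).trans ?_
      · rw [Bool.eq_iff_iff, label_limitPoint]
        refine ⟨fun h => ⟨h, ?_⟩, And.left⟩
        rcases Nat.lt_succ_iff_lt_or_eq.1 hi with hi | rfl
        · obtain ⟨w, hw, hpw⟩ := LimitSpace.exists_core_of_red h
          exact Set.mem_biUnion hw (core_subset_core hi (pos_mem_core hp) hpw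
            (center_mem_core l z))
        · exact hcz
      · have : dist p.pos c₀ ≤ P.slen (l + 1) := by
          rw [Subtype.dist_eq, EuclideanSpace.dist_eq, Real.sqrt_le_left hs0.le]
          simp only [Real.dist_eq, sq_abs, Fin.sum_univ_three]
          have h := fun i => sq_le_sq' (abs_le.1 (hp i)).1 (abs_le.1 (hp i)).2
          have h0 := h 0
          have h1 := h 1
          have h2 := h 2
          simp only [hc₀]
          nlinarith
        change dist p.pos c₀ + _ ≤ _
        linarith
    have h2 : dist (limitPoint c₀ p.label : LimitSpace P) (limitPoint c₀ c') ≤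
        P.jumpLen l + 6 * P.slen (l + 1) := by
      rw [← ENNReal.ofReal_le_ofReal_iff (by positivity), ENNReal.ofReal_add hJ0.le
        (by positivity), ← edist_dist]
      refine (LimitSpace.edist_le_levelDist_add _ _ (l + 1)).trans ?_
      gcongr
      refine (chainInf_le _ _).trans ?_
      have hproj : (sheetPoint (l + 1) c₀ p.label : Level P (l + 1)).proj =
          (sheetPoint (l + 1) c₀ c' : Level P (l + 1)).proj :=
        Level.ext rfl (funext fun i => by
          simp [sheetPoint, Level.proj, hc', Function.update_of_ne i.2.ne])
      have hlast : (sheetPoint (l + 1) c₀ p.label : Level P (l + 1)).lastCol ≠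
          (sheetPoint (l + 1) c₀ c' : Level P (l + 1)).lastCol := by
        simp [Level.lastCol, sheetPoint, hcz, hc']
      change stepCost _ (sheetPoint (l + 1) c₀ p.label : Level P (l + 1))
        (sheetPoint (l + 1) c₀ c') ≤ _
      rw [stepCost, if_neg (not_coverSheet hz (center_mem_core l z) (center_mem_core l z)
        (congrArg Level.col hproj) hlast), if_pos ⟨hproj, hlast, z, hz, rfl⟩]
    rw [dist_comm]
    linarith [dist_triangle p (limitPoint c₀ p.label) (limitPoint c₀ c')]
  · have := label_limitPoint (P := P) c₀ c' l
    rw [h] at this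
    simp [hcz, hc'] at this

end gate

/-! ### Disconnected tangents at points lying in infinitely many central cells -/

/-- Total boundedness of balls, in the form needed for `UniformlyTotallyBounded`. -/
theorem exists_finite_coloring {E : Type*} [SeminormedAddCommGroup E] [ProperSpace E] (R : ℝ)
    {ε : ℝ} (hε : 0 < ε) : ∃ (F : Type) (_ : Finite F) (φ : E → F),
      ∀ u v, ‖u‖ ≤ R → ‖v‖ ≤ R → φ u = φ v → dist u v ≤ ε := by
  classical
  obtain ⟨t, -, ht, hcov⟩ := (isCompact_closedBall (0 : E) R).finite_cover_balls (half_pos hε)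
  have hn : ∀ u : E, ‖u‖ ≤ R → ∃ c : t, dist u c < ε / 2 := by
    intro u hu
    obtain ⟨c, hc, huc⟩ := Set.mem_iUnion₂.1 (hcov (mem_closedBall_zero_iff.2 hu))
    exact ⟨⟨c, hc⟩, huc⟩
  have := ht.to_subtype
  obtain ⟨k, ⟨e⟩⟩ := Finite.exists_equiv_fin t
  refine ⟨Option (Fin k), inferInstance,
    fun u => if h : ∃ c : t, dist u c < ε / 2 then some (e h.choose) else none,
    fun u v hu hv huv => ?_⟩
  simp only [dif_pos (hn u hu), dif_pos (hn v hv), Option.some.injEq, e.injective.eq_iff] at huv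
  have h1 := (hn u hu).choose_spec
  have h2 := (hn v hv).choose_spec
  rw [huv] at h1
  linarith [dist_triangle_right u v ((hn v hv).choose : E)]

/-- The scales are the jump lengths of the diamonds in whose central cells `p` lies, and the two
pieces are distinguished by the colour chosen in the diamond. -/
theorem exists_disconnected_tangent_of_frequently {p : LimitSpace P}
    (h : ∃ᶠ l in atTop, InGate P l p.pos) :
    ∃ (Y : Type) (_ : MetricSpace Y) (q : Y), IsTangent p q ∧ ¬ ConnectedSpace Y := by
  obtain ⟨l, hl, hgate⟩ := extraction_of_frequently_atTop h
  choose z hz hp using hgate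
  choose p' hp' hp'l using fun m => exists_mate (hz m) (hp m)
  have hJ : ∀ m, 0 < P.jumpLen (l m) := fun m => P.jumpLen_pos _
  have hn : ∀ R : ℝ, ∀ᶠ m in atTop, 2 * R + 4 ≤ P.diamParam (l m) := fun R =>
    (tendsto_natCast_atTop_atTop.comp (P.tendsto_diamParam.comp hl.tendsto_atTop)).eventually_ge_atTop
      (2 * R + 4)
  refine exists_disconnected_tangent (r := fun m => P.jumpLen (l m)) (C := 3) hJ
    (P.tendsto_jumpLen.comp hl.tendsto_atTop) ?_ (fun m x => x.label (l m)) (fun R => ?_) p'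
    (fun m => (div_le_iff₀ (hJ m)).2 (hp' m)) hp'l
  · intro R hR ε hε
    obtain ⟨F, _, φ, hφ⟩ := exists_finite_coloring (E := E3) R (half_pos hε)
    obtain ⟨T, hT⟩ := exists_pow_lt_of_lt_one (half_pos hε) (by norm_num : (1 / 2 : ℝ) < 1)
    -- `T` steps after the `l m`-th one, the cells are small compared to the jump length
    refine ⟨F × (Fin (1 + T) → Bool), inferInstance, fun m x =>
      (φ ((P.jumpLen (l m))⁻¹ • ((x.pos : E3) - p.pos)), fun i => x.label (l m + i)), ?_⟩
    filter_upwards [hn R] with m hm x y hx hy hxy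
    obtain ⟨hpos, hlab⟩ := Prod.ext_iff.1 hxy
    have hJm := hJ m
    rw [div_lt_iff₀ hJm] at hx hy
    have hnorm : ∀ u : LimitSpace P, dist u p < R * P.jumpLen (l m) →
        ‖(P.jumpLen (l m))⁻¹ • ((u.pos : E3) - p.pos)‖ ≤ R := by
      intro u hu
      rw [norm_smul, Real.norm_of_nonneg (inv_nonneg.2 hJm.le), ← dist_eq_norm,
        inv_mul_le_iff₀ hJm, mul_comm]
      exact (LimitSpace.dist_pos_le u p).trans hu.le
    have h1 := hφ _ _ (hnorm x hx) (hnorm y hy) hpos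
    rw [dist_smul₀, dist_sub_right, Real.norm_of_nonneg (inv_nonneg.2 hJm.le),
      inv_mul_le_iff₀ hJm] at h1
    have h2 : ∀ i < l m + 1 + T, x.label i = y.label i := by
      intro i hi
      rcases lt_or_ge i (l m) with hil | hil
      · rw [label_eq_of_dist_lt (hp m) (by linarith) hx hil,
          label_eq_of_dist_lt (hp m) (by linarith) hy hil]
      · obtain ⟨j, rfl⟩ := Nat.exists_eq_add_of_le hil
        exact congrFun hlab ⟨j, by omega⟩
    have h3 := LimitSpace.dist_le_of_label_eq h2
    have h4 := P.slen_add_le (l m + 1) T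
    have h5 := P.slen_succ_le_jumpLen (l m)
    have h6 := P.slen_pos (l m + 1)
    rw [Subtype.dist_eq] at h3
    rw [div_le_iff₀ hJm]
    nlinarith
  · filter_upwards [hn R] with m hm x y hx hy hxy
    rw [div_lt_iff₀ (hJ m)] at hx hy
    rw [one_le_div (hJ m)]
    exact jumpLen_le_dist (hz m) (hp m) hm hx hy hxy

/-! ### Grid cells of points of the cube -/

variable (P : Params)

/-- The grid cube of level `l` containing a point of the unit cube. Half-open intervals are used,
except that the last interval in each direction is closed. -/
def cellOf (l : ℕ) (x : E3) : Fin 3 → ℕ := fun i => min ⌊x i * P.gridSize l⌋₊ (P.gridSize l - 1)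

theorem cellOf_mem_gridCells (l : ℕ) (x : E3) : cellOf P l x ∈ gridCells P l := by
  intro i
  have := P.gridSize_pos l
  simp only [cellOf]
  omega

theorem abs_sub_center_cellOf_le (l : ℕ) (x : Cube) (i : Fin 3) :
    |(x : E3) i - center P l (cellOf P l x) i| ≤ P.slen l / 2 := by
  have hg : 0 < P.gridSize l := P.gridSize_pos l
  have hg' : (0 : ℝ) < P.gridSize l := by exact_mod_cast hg
  obtain ⟨hx0, hx1⟩ := x.2 i
  have hfloor := Nat.floor_le (mul_nonneg hx0 hg'.le)
  have hlt := Nat.lt_floor_add_one ((x : E3) i * P.gridSize l)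
  have h1 : ((cellOf P l x i : ℕ) : ℝ) ≤ (x : E3) i * P.gridSize l :=
    le_trans (by exact_mod_cast min_le_left _ _) hfloor
  have h2 : (x : E3) i * P.gridSize l ≤ (cellOf P l x i : ℕ) + 1 := by
    simp only [cellOf]
    rcases min_choice ⌊(x : E3) i * P.gridSize l⌋₊ (P.gridSize l - 1) with h | h <;> rw [h]
    · exact hlt.le
    · rw [Nat.cast_sub hg, Nat.cast_one, sub_add_cancel]
      exact mul_le_of_le_one_left hg'.le hx1
  have h3 : (x : E3) i = (x : E3) i * P.gridSize l * P.slen l := by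
    unfold Params.slen; field_simp
  have hs := P.slen_pos l
  simp only [center]
  rw [h3, ← sub_mul, abs_mul, abs_of_pos hs]
  have h4 : |(x : E3) i * P.gridSize l - ((cellOf P l x i : ℕ) + 1 / 2)| ≤ 1 / 2 := by
    rw [abs_le]
    constructor <;> linarith
  nlinarith

theorem parent_cellOf (l : ℕ) (x : E3) : parent P l (cellOf P (l + 1) x) = cellOf P l x := by
  funext i
  have hs := P.sub_pos l
  have hg := P.gridSize_pos l
  simp only [parent, cellOf, Params.gridSize]
  have hmono : Monotone fun a : ℕ => a / P.sub l := fun a b h => Nat.div_le_div_right h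
  refine (hmono.map_min).trans ?_
  rw [← Nat.floor_div_natCast]
  congr 1
  · congr 1
    have : (P.sub l : ℝ) ≠ 0 := by positivity
    push_cast
    field_simp
  · obtain ⟨g, hg'⟩ := Nat.exists_eq_add_of_lt hg
    rw [hg', Nat.div_eq_iff hs]
    simp only [zero_add, Nat.add_sub_cancel, add_mul, one_mul]
    constructor <;> omega

/-- A central subcell has the same centre as its parent. -/
theorem center_of_isCentral {l : ℕ} {w : Fin 3 → ℕ} (h : IsCentral P l w) :
    center P (l + 1) w = center P l (parent P l w) := by
  ext i
  simp only [center, parent]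
  rw [P.slen_succ l]
  have h1 : w i = P.sub l * (w i / P.sub l) + P.N (P.diamParam l) := by
    rw [← h i, Nat.div_add_mod]
  have h2 : (w i : ℝ) = P.sub l * (w i / P.sub l : ℕ) + P.N (P.diamParam l) := by
    exact_mod_cast h1
  have h3 : (P.sub l : ℝ) = 2 * P.N (P.diamParam l) + 1 := by
    unfold Params.sub; push_cast; ring
  rw [h2]
  set a : ℝ := ((w i / P.sub l : ℕ) : ℝ)
  rw [h3]; ring

theorem inGate_of_isCentral {l : ℕ} {x : Cube} (hz : cellOf P l x ∈ toDouble P l)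
    (h : IsCentral P l (cellOf P (l + 1) x)) : InGate P l x := by
  refine ⟨_, hz, fun i => ?_⟩
  rw [← parent_cellOf, ← center_of_isCentral P h]
  exact abs_sub_center_cellOf_le P (l + 1) x i

/-- Suppose that a point lies in no gate created after the beginning of a block. Then its cell is
never a gate from there on, so it is always doubled, and the next cell is never the central
one. -/
theorem not_isCentral_of_not_inGate {k : ℕ} {x : Cube}
    (h : ∀ l, P.nbar k ≤ l → ¬ InGate P l x) {l : ℕ} (hl : P.nbar k ≤ l) :
    ¬ IsCentral P l (cellOf P (l + 1) x) := by
  suffices hz : cellOf P l x ∈ toDouble P l from fun hc => h l hl (inGate_of_isCentral P hz hc)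
  induction l, hl using Nat.le_induction with
  | base => exact ⟨cellOf_mem_gridCells P _ x, Or.inl ⟨k, rfl⟩⟩
  | succ l hl ih =>
    refine ⟨cellOf_mem_gridCells P _ x, Or.inr fun hg => ?_⟩
    rcases hg.2 with hg | hg
    · exact h l hl (inGate_of_isCentral P ih hg.2)
    · exact hg.1 (by rw [parent_cellOf]; exact ih)

/-! ### Almost every point lies in infinitely many central cells -/

open scoped Classical in
/-- The cells of level `L + k` none of whose ancestors at levels `L + 1, …, L + k` is the central
subcell of its parent. -/
def noncentralCells (L : ℕ) : ℕ → Finset (Fin 3 → ℕ)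
  | 0 => Fintype.piFinset fun _ => Finset.range (P.gridSize L)
  | k + 1 => {w ∈ Fintype.piFinset fun _ => Finset.range (P.gridSize (L + (k + 1))) |
      parent P (L + k) w ∈ noncentralCells L k ∧ ¬ IsCentral P (L + k) w}

theorem cellOf_mem_noncentralCells {L : ℕ} {x : E3}
    (h : ∀ l, L ≤ l → ¬ IsCentral P l (cellOf P (l + 1) x)) (k : ℕ) :
    cellOf P (L + k) x ∈ noncentralCells P L k := by
  classical
  have hgrid : ∀ l, cellOf P l x ∈ Fintype.piFinset fun _ => Finset.range (P.gridSize l) :=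
    fun l => Fintype.mem_piFinset.2 fun i => Finset.mem_range.2 (cellOf_mem_gridCells P l x i)
  induction k with
  | zero => exact hgrid L
  | succ k ih =>
    refine Finset.mem_filter.2 ⟨hgrid _, ?_, h _ (Nat.le_add_right L k)⟩
    rwa [show L + (k + 1) = L + k + 1 from rfl, parent_cellOf]

theorem card_noncentralCells_succ_le (L k : ℕ) :
    (noncentralCells P L (k + 1)).card ≤
      (noncentralCells P L k).card * (P.sub (L + k) ^ 3 - 1) := by
  classical
  have hN : (fun _ => P.N (P.diamParam (L + k))) ∈
      Fintype.piFinset fun _ : Fin 3 => Finset.range (P.sub (L + k)) :=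
    Fintype.mem_piFinset.2 fun i => Finset.mem_range.2 (by unfold Params.sub; omega)
  have hcard : ((Fintype.piFinset fun _ : Fin 3 => Finset.range (P.sub (L + k))).erase
      (fun _ => P.N (P.diamParam (L + k)))).card = P.sub (L + k) ^ 3 - 1 := by
    rw [Finset.card_erase_of_mem hN, Fintype.card_piFinset_const, Finset.card_range]
  rw [← hcard, ← Finset.card_product]
  -- a cell is determined by its parent and its position in it
  refine Finset.card_le_card_of_injOn
    (fun w => (parent P (L + k) w, fun i => w i % P.sub (L + k))) (fun w hw => ?_) ?_
  · obtain ⟨-, h1, h2⟩ := Finset.mem_filter.1 hw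
    refine Finset.mem_product.2 ⟨h1, Finset.mem_erase.2 ⟨fun h => h2 fun i => congrFun h i,
      Fintype.mem_piFinset.2 fun i => Finset.mem_range.2 (Nat.mod_lt _ (P.sub_pos _))⟩⟩
  · intro w _ w' _ h
    obtain ⟨h1, h2⟩ := Prod.ext_iff.1 h
    funext i
    rw [← Nat.div_add_mod (w i) (P.sub (L + k)), ← Nat.div_add_mod (w' i) (P.sub (L + k)),
      show w i / P.sub (L + k) = w' i / P.sub (L + k) from congrFun h1 i,
      show w i % P.sub (L + k) = w' i % P.sub (L + k) from congrFun h2 i]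

/-- The left side is the total volume of the cells in `noncentralCells P L k`. -/
theorem card_noncentralCells_mul_le (L k : ℕ) :
    (noncentralCells P L k).card * P.slen (L + k) ^ 3 ≤
      Real.exp (-∑ j ∈ Finset.range k, 1 / (P.sub (j + L) : ℝ) ^ 3) := by
  induction k with
  | zero =>
    have h : (0 : ℝ) < P.gridSize L := by exact_mod_cast P.gridSize_pos L
    simp only [noncentralCells, Fintype.card_piFinset_const, Finset.card_range, Params.slen,
      add_zero, Finset.range_zero, Finset.sum_empty, neg_zero, Real.exp_zero]
    push_cast
    rw [← mul_pow, mul_one_div_cancel h.ne', one_pow]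
  | succ k ih =>
    have hs : (0 : ℝ) < P.sub (L + k) := by exact_mod_cast P.sub_pos (L + k)
    have hs0 := P.slen_pos (L + (k + 1))
    have h1 : ((noncentralCells P L (k + 1)).card : ℝ) ≤
        (noncentralCells P L k).card * ((P.sub (L + k) : ℝ) ^ 3 - 1) := by
      have hpos : 1 ≤ P.sub (L + k) ^ 3 := Nat.one_le_pow _ _ (P.sub_pos _)
      have := card_noncentralCells_succ_le P L k
      have h2 : (((P.sub (L + k) ^ 3 - 1 : ℕ)) : ℝ) = (P.sub (L + k) : ℝ) ^ 3 - 1 := by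
        push_cast [Nat.cast_sub hpos]; ring
      rw [← h2]
      exact_mod_cast this
    rw [Finset.sum_range_succ, neg_add, Real.exp_add, add_comm k L]
    calc _ ≤ (noncentralCells P L k).card * ((P.sub (L + k) : ℝ) ^ 3 - 1) *
          P.slen (L + (k + 1)) ^ 3 := by gcongr
      _ = (noncentralCells P L k).card * P.slen (L + k) ^ 3 *
          (1 - 1 / (P.sub (L + k) : ℝ) ^ 3) := by
        rw [P.slen_succ (L + k), ← add_assoc]
        field_simp
      _ ≤ _ := by
        have := P.slen_pos (L + k)
        have h3 := Real.one_sub_le_exp_neg (1 / (P.sub (L + k) : ℝ) ^ 3)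
        exact mul_le_mul ih h3 (sub_nonneg.2 (by
          rw [div_le_one (by positivity)]
          exact one_le_pow₀ (by exact_mod_cast P.sub_pos (L + k)))) (Real.exp_pos _).le

/-- A block with parameter `n` consists of `n ^ 3` levels and each of them contributes at least
`1 / (128 * n) ^ 3` to the sum of the volume fractions of the central cells. -/
theorem tendsto_sum_sub (L : ℕ) :
    Tendsto (fun k => ∑ j ∈ Finset.range k, 1 / (P.sub (j + L) : ℝ) ^ 3) atTop atTop := by
  have hnn : ∀ l, 0 ≤ 1 / (P.sub l : ℝ) ^ 3 := fun l => by positivity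
  have hblock : ∀ k : ℕ,
      (k : ℝ) * (1 / 128 ^ 3) ≤ ∑ l ∈ Finset.range (P.nbar k), 1 / (P.sub l : ℝ) ^ 3 := by
    intro k
    induction k with
    | zero => simpa using Finset.sum_nonneg fun l _ => hnn l
    | succ k ih =>
      have hn0 : (0 : ℝ) < ((P.n₀ + (k + 1) : ℕ) : ℝ) := by positivity
      have hterm : ∀ i ∈ Finset.range ((P.n₀ + (k + 1)) ^ 3),
          (1 / (128 * ((P.n₀ + (k + 1) : ℕ) : ℝ))) ^ 3 ≤
            1 / (P.sub (P.nbar k + i) : ℝ) ^ 3 := by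
        intro i hi
        have hb : P.diamParam (P.nbar k + i) = P.n₀ + (k + 1) := by
          rw [Params.diamParam, P.block_eq (k := k) (Nat.le_add_right _ _)]
          rw [P.nbar_succ]
          have := Finset.mem_range.1 hi
          omega
        have h1 := (P.N_size (P.diamParam (P.nbar k + i))
          (by have := P.diamParam_ge (P.nbar k + i); omega)).1
        have h2 : (P.sub (P.nbar k + i) : ℝ) = 2 * P.N (P.diamParam (P.nbar k + i)) + 1 := by
          unfold Params.sub; push_cast; ring
        rw [← h2, hb] at h1
        rw [← one_div_pow]
        gcongr
      rw [P.nbar_succ, Finset.sum_range_add]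
      have h3 := Finset.card_nsmul_le_sum _ _ _ hterm
      rw [Finset.card_range, nsmul_eq_mul] at h3
      have h4 : (((P.n₀ + (k + 1)) ^ 3 : ℕ) : ℝ) *
          (1 / (128 * ((P.n₀ + (k + 1) : ℕ) : ℝ))) ^ 3 = 1 / 128 ^ 3 := by
        rw [Nat.cast_pow]
        field_simp
      rw [h4] at h3
      push_cast
      linarith
  rw [← not_summable_iff_tendsto_nat_atTop_of_nonneg fun j => hnn (j + L),
    summable_nat_add_iff L (f := fun l => 1 / (P.sub l : ℝ) ^ 3)]
  intro hsum
  obtain ⟨k, hk⟩ := exists_nat_gt ((∑' l, 1 / (P.sub l : ℝ) ^ 3) * 128 ^ 3)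
  have h1 := hsum.sum_le_tsum (Finset.range (P.nbar k)) fun l _ => hnn l
  have h2 := hblock k
  linarith

theorem cubeMeasure_cell_le (c : E3) {s : ℝ} (hs : 0 ≤ s) :
    cubeMeasure {x : Cube | ∀ i, |(x : E3) i - c i| ≤ s / 2} ≤ ENNReal.ofReal (s ^ 3) := by
  have hm : MeasurableSet {x : E3 | ∀ i, x i ∈ Set.Icc (0 : ℝ) 1} := by
    rw [Set.ofPred_forall]
    exact MeasurableSet.iInter fun i => measurableSet_Icc.preimage (by fun_prop)
  have h := (PiLp.volume_preserving_ofLp (Fin 3)).measure_preimage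
    (s := Set.univ.pi fun i => Set.Icc (c i - s / 2) (c i + s / 2))
    (MeasurableSet.univ_pi fun _ => measurableSet_Icc).nullMeasurableSet
  rw [volume_pi_pi] at h
  refine ((comap_subtype_coe_apply hm volume _).trans_le (measure_mono ?_)).trans
    (h.trans_le (le_of_eq ?_))
  · rintro _ ⟨x, hx, rfl⟩ i -
    have := abs_le.1 (hx i)
    constructor <;> linarith
  · simp only [Real.volume_Icc, Fin.prod_univ_three, add_sub_sub_cancel, add_halves]
    rw [← ENNReal.ofReal_mul hs, ← ENNReal.ofReal_mul (by positivity)]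
    congr 1; ring

theorem cubeMeasure_never_central (L : ℕ) :
    cubeMeasure {x : Cube | ∀ l, L ≤ l → ¬ IsCentral P l (cellOf P (l + 1) x)} = 0 := by
  have hbound : ∀ k, cubeMeasure {x : Cube | ∀ l, L ≤ l → ¬ IsCentral P l (cellOf P (l + 1) x)} ≤
      ENNReal.ofReal (Real.exp (-∑ j ∈ Finset.range k, 1 / (P.sub (j + L) : ℝ) ^ 3)) := by
    intro k
    have hs := (P.slen_pos (L + k)).le
    calc _ ≤ cubeMeasure (⋃ z ∈ noncentralCells P L k,
          {x : Cube | ∀ i, |(x : E3) i - center P (L + k) z i| ≤ P.slen (L + k) / 2}) :=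
          measure_mono fun x hx => Set.mem_biUnion (cellOf_mem_noncentralCells P hx k)
            (abs_sub_center_cellOf_le P (L + k) x)
      _ ≤ ∑ z ∈ noncentralCells P L k, ENNReal.ofReal (P.slen (L + k) ^ 3) :=
          (measure_biUnion_finset_le _ _).trans
            (Finset.sum_le_sum fun z _ => cubeMeasure_cell_le _ hs)
      _ = ENNReal.ofReal ((noncentralCells P L k).card * P.slen (L + k) ^ 3) := by
          rw [Finset.sum_const, nsmul_eq_mul, ENNReal.ofReal_mul (Nat.cast_nonneg _),
            ENNReal.ofReal_natCast]
      _ ≤ _ := ENNReal.ofReal_le_ofReal (card_noncentralCells_mul_le P L k)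
  refine le_antisymm (ge_of_tendsto' (x := atTop) ?_ hbound) zero_le
  have := (Real.tendsto_exp_neg_atTop_nhds_zero.comp (tendsto_sum_sub P L))
  simpa using ENNReal.tendsto_ofReal this

theorem ae_frequently_inGate : ∀ᵐ x ∂cubeMeasure, ∃ᶠ l in atTop, InGate P l (x : Cube) := by
  have h : ∀ᵐ x ∂cubeMeasure, ∀ k,
      ¬ ∀ l, P.nbar k ≤ l → ¬ IsCentral P l (cellOf P (l + 1) (x : Cube)) :=
    ae_all_iff.2 fun k => by
      rw [ae_iff]
      simpa using cubeMeasure_never_central P (P.nbar k)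
  filter_upwards [h] with x hx hev
  obtain ⟨k, hk⟩ := eventually_atTop.1 hev
  exact hx k fun l hl => not_isCentral_of_not_inGate P
    (fun l' hl' => hk l' ((P.le_nbar k).trans hl')) hl

theorem measurableSet_frequently_inGate :
    MeasurableSet {x : LimitSpace P | ∃ᶠ l in atTop, InGate P l x.pos} := by
  have hpos : Continuous (LimitSpace.pos : LimitSpace P → Cube) :=
    (LipschitzWith.of_dist_le' (K := 1) fun x y => by
      simpa using LimitSpace.dist_pos_le x y).continuous
  have h : ∀ l, MeasurableSet {x : LimitSpace P | InGate P l x.pos} := by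
    intro l
    simp only [InGate, ← exists_prop, Set.ofPred_exists, Set.ofPred_forall]
    refine MeasurableSet.iUnion fun z => MeasurableSet.iUnion fun _ =>
      MeasurableSet.iInter fun i => ?_
    exact (isClosed_le (by fun_prop) continuous_const).measurableSet
  convert MeasurableSet.measurableSet_limsup h using 1
  ext x
  rw [mem_limsup_iff_frequently_mem]
  rfl

theorem ae_limitMeasure_frequently_inGate :
    ∀ᵐ p ∂limitMeasure P, ∃ᶠ l in atTop, InGate P l p.pos := by
  rw [limitMeasure, ae_map_iff continuous_limitPoint.measurable.aemeasurable
    (measurableSet_frequently_inGate P)]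
  exact Measure.quasiMeasurePreserving_fst.ae (ae_frequently_inGate P)

end NqcDiamond

end

theorem mainTheorem2 (P : NqcDiamond.Params) :
    ∀ᵐ p ∂(NqcDiamond.limitMeasure P),
      ∃ (Y : Type) (_ : MetricSpace Y) (q : Y),
        NqcDiamond.IsTangent p q ∧ ¬ ConnectedSpace Y := by
  filter_upwards [NqcDiamond.ae_limitMeasure_frequently_inGate P] with p hp
  exact NqcDiamond.exists_disconnected_tangent_of_frequently hp
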